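/- Let $\delta\in\mathbb C$ with $\Re\delta>-1/2$, and on the unit circle let $w_1(e^{i\theta})=(1-e^{i\theta})^{\bar\delta}(1-e^{-i\theta})^{\delta}$ (principal powers) and $\widetilde w_1=c(\delta)w_1$, $c(\delta)=\frac{1}{2\pi}\frac{\Gamma(1+\delta)\Gamma(1+\bar\delta)}{\Gamma(1+\delta+\bar\delta)}$. Let $\varphi_0,\varphi_1,\dots$ be the orthonormal polynomials with respect to $\widetilde w_1(e^{i\theta})\,d\theta$ on $(-\pi,\pi)$ and $$\widetilde K_n(z,\zeta)=\sqrt{\widetilde w_1(z)\widetilde w_1(\zeta)}\sum_{\ell=0}^{n-1}\overline{\varphi_\ell(z)}\,\varphi_\ell(\zeta).$$ Let ${}_1F_1(b;c;z)=\sum_{k\ge0}\frac{(b)_k}{(c)_k}\frac{z^k}{k!}$, $$P(\theta)=|\theta|^{\Re\delta}\,e^{\frac{i\theta}{2}-\frac{\pi}{2}\Im\delta\,\operatorname{sgn}\theta}\;{}_1F_1(\delta;\delta+\bar\delta+1;-i\theta),\qquad G(\delta)=\frac{\Gamma(1+\delta)\Gamma(1+\bar\delta)}{\Gamma(1+\delta+\bar\delta)^2},$$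 and define, for $\theta\ne\tau$, $$\widetilde K_\infty(\theta,\tau)=\frac{G(\delta)}{2i\pi}\,\frac{P(\theta)\overline{P(\tau)}-\overline{P(\theta)}P(\tau)}{\theta-\tau},$$ and on the diagonal $$\widetilde K_\infty(\theta,\theta)=\frac{|\theta|^{2\Re\delta}e^{-\pi\Im\delta\,\operatorname{sgn}\theta}}{2\pi}\,G(\delta)\,\Re\Big[{}_1F_1(\delta;\delta+\bar\delta+1;-i\theta)\Big({}_1F_1(\bar\delta;\delta+\bar\delta+1;i\theta)-\tfrac{2\bar\delta}{\delta+\bar\delta+1}\,{}_1F_1(\bar\delta+1;\delta+\bar\delta+2;i\theta)\Big)\Big].$$ Below, all angles $\theta,\tau,\theta_1,\dots,\theta_m$ are real numbers, and they are non-zero unless $\delta=0$ or $\Re\delta>0$ (in the remaining cases $w_1$ is infinite or has no limit at $1$). 1. For all such $\theta,\tau$, $$\lim_{n\to\infty} n^{-1}\widetilde K_n(e^{i\theta/n},e^{i\tau/n})=e^{-i(\theta-\tau)/2}\,\widetilde K_\infty(\theta,\tau).$$ Moreover $P(\theta)=\widetilde P(-2\theta^{-1})$ for $\theta\neq0$,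 where $\widetilde P(x)=|2/x|^{\Re\delta}e^{-\frac ix+\frac\pi2\Im\delta\operatorname{sgn}x}{}_1F_1(\delta;\delta+\bar\delta+1;2i/x)$. 2. For $m\le n$ let $$\rho_{n,m}(e^{i\theta_1},\dots,e^{i\theta_m})=\frac{n!}{(n-m)!}\int_{(-\pi,\pi]^{n-m}}p_n(\theta_1,\dots,\theta_n)\,d\theta_{m+1}\cdots d\theta_n ,$$ where $p_n(\theta_1,\dots,\theta_n)=\frac1{\mathcal Z_n}\prod_jw_1(e^{i\theta_j})\prod_{j<k}|e^{i\theta_k}-e^{i\theta_j}|^2$ is the normalized joint density of the eigenangles. Then $\rho_{n,m}$ is an $m$-point correlation function (joint intensity) of the point process $\nu_n=\sum_j\delta_{\theta_j}$: it is integrable, and $\mathbb E\big[\prod_{i=1}^m\nu_n(D_i)\big]=\int_{D_1\times\cdots\times D_m}\rho_{n,m}$ for pairwise disjoint measurable $D_i\subseteq(-\pi,\pi]$. For every $m$ and all such $\theta_1,\dots,\theta_m$, $$\lim_{n\to\infty}n^{-m}\rho_{n,m}(e^{i\theta_1/n},\dots,e^{i\theta_m/n})=\det\big(\widetilde K_\infty(\theta_i,\theta_j)\big)_{1\le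 i,j\le m}.$$ -/

import Mathlib

open Filter Topology MeasureTheory Polynomial
open scoped ComplexConjugate Nat Real

namespace CircularJacobi

noncomputable section

/-! ### The weight -/

/-- The circular Jacobi weight `(1 - z) ^ conj δ * (1 - z⁻¹) ^ δ` at a point `z` of the unit circle
(principal powers).  For `z ≠ 1` the two factors are complex conjugates of each other, so the product
is a positive real number; it is recorded as a real number. -/
def weight (δ z : ℂ) : ℝ := ((1 - z) ^ conj δ * (1 - z⁻¹) ^ δ).re

/-- The normalising constant `c(δ) = Γ(1 + δ) Γ(1 + conj δ) / (2 π Γ(1 + δ + conj δ))`; note that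
`Γ(1 + δ) Γ(1 + conj δ) = |Γ(1 + δ)| ^ 2`. -/
def normConst (δ : ℂ) : ℝ :=
  1 / (2 * π) * (‖Complex.Gamma (1 + δ)‖ ^ 2 / Real.Gamma (1 + 2 * δ.re))

/-- The normalised weight. -/
def nweight (δ z : ℂ) : ℝ := normConst δ * weight δ z

/-! ### Orthogonal polynomials on the unit circle and their kernel -/

/-- The point `e ^ (i θ)` of the unit circle. -/
def circPt (θ : ℝ) : ℂ := Complex.exp (Complex.I * θ)

/-- The scalar product `∫ conj (f (e ^ (i θ))) g (e ^ (i θ)) w (e ^ (i θ)) dθ` over `(-π, π)`. -/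
def circInner (w : ℂ → ℝ) (f g : ℂ[X]) : ℂ :=
  ∫ θ in (-π)..π, conj (f.eval (circPt θ)) * g.eval (circPt θ) * (w (circPt θ) : ℂ)

/-- The monic orthogonal polynomials for the weight `w` (orthogonalisation of `1, X, X ^ 2, …`). -/
def monicOP (w : ℂ → ℝ) : ℕ → ℂ[X]
  | n => X ^ n - ∑ l : Fin n,
      C (circInner w (monicOP w l) (X ^ n) / circInner w (monicOP w l) (monicOP w l)) * monicOP w l
decreasing_by all_goals exact l.2

/-- The orthonormal polynomials for the weight `w`, with positive leading coefficients. -/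
def orthonormalOP (w : ℂ → ℝ) (n : ℕ) : ℂ[X] :=
  C (((√(circInner w (monicOP w n) (monicOP w n)).re)⁻¹ : ℝ) : ℂ) * monicOP w n

/-- The normalised reproducing kernel
`√(w z * w ζ) * ∑ l < n, conj (φ_l z) * φ_l ζ`. -/
def kernel (w : ℂ → ℝ) (n : ℕ) (z ζ : ℂ) : ℂ :=
  (√(w z * w ζ) : ℂ) *
    ∑ l ∈ Finset.range n, conj ((orthonormalOP w l).eval z) * (orthonormalOP w l).eval ζ

/-! ### The eigenvalue process and its correlation functions -/

/-- The unnormalised joint density `∏ w (e ^ (i θ_j)) * ∏_{j < k} |e ^ (i θ_k) - e ^ (i θ_j)| ^ 2`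
of `N` eigenangles. -/
def jointWeight (w : ℂ → ℝ) {N : ℕ} (θ : Fin N → ℝ) : ℝ :=
  (∏ j, w (circPt (θ j))) *
    ∏ j, ∏ k ∈ Finset.Ioi j, ‖circPt (θ k) - circPt (θ j)‖ ^ 2

/-- The cube `(-π, π] ^ N` of angles. -/
def angleBox (N : ℕ) : Set (Fin N → ℝ) := Set.univ.pi fun _ => Set.Ioc (-π) π

/-- The normalisation constant of the joint density. -/
def partitionFn (w : ℂ → ℝ) (N : ℕ) : ℝ :=
  ∫ θ in angleBox N, jointWeight w θ

/-- The law of the `N` eigenangles. -/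
def angleLaw (w : ℂ → ℝ) (N : ℕ) : Measure (Fin N → ℝ) :=
  (volume.restrict (angleBox N)).withDensity fun θ =>
    ENNReal.ofReal (jointWeight w θ / partitionFn w N)

/-- `ρ` is an `m`-th correlation function (joint intensity) of the point process
`ν = ∑ j, δ_{θ_j}` of `n` angles with law `P`: it is integrable, and for pairwise disjoint
`D_1, …, D_m` the expectation of `∏ ν (D_i)` is the integral of `ρ` over `∏ D_i`. -/
def IsJointIntensity {n m : ℕ} (P : Measure (Fin n → ℝ)) (ρ : (Fin m → ℝ) → ℝ) : Prop :=
  IntegrableOn ρ (angleBox m) ∧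
    ∀ D : Fin m → Set ℝ, (∀ i, MeasurableSet (D i)) → (∀ i, D i ⊆ Set.Ioc (-π) π) →
      Pairwise (fun i j => Disjoint (D i) (D j)) →
        ∫ θ, ∏ i, (∑ j, Measure.dirac (θ j)).real (D i) ∂P = ∫ x in Set.univ.pi D, ρ x

/-- The `m`-point correlation function of the `n` eigenvalues, as a function of the angles
(the usual pointwise version):
`n! / (n - m)!` times the integral of the joint probability density over the last `n - m` angles.
It is used for `m ≤ n` only, where `m + (n - m) = n`. -/
def corr (w : ℂ → ℝ) (n m : ℕ) (x : Fin m → ℝ) : ℝ :=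
  (n.descFactorial m : ℝ) *
    ((∫ y in angleBox (n - m), jointWeight w (Fin.append x y)) / partitionFn w n)

/-! ### The limiting kernel -/

/-- The confluent hypergeometric function `₁F₁(b; c; z)`. -/
def hyp1F1 (b c z : ℂ) : ℂ :=
  ∑' k : ℕ, (ascPochhammer ℂ k).eval b / (ascPochhammer ℂ k).eval c * (z ^ k / (k ! : ℂ))

/-- `Γ(1 + δ) Γ(1 + conj δ) / Γ(1 + δ + conj δ) ^ 2`. -/
def gammaFactor (δ : ℂ) : ℝ :=
  ‖Complex.Gamma (1 + δ)‖ ^ 2 / Real.Gamma (1 + 2 * δ.re) ^ 2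

/-- The function `P(θ) = |θ| ^ Re δ * e ^ (i θ / 2 - (π / 2) Im δ sgn θ)
* ₁F₁(δ; δ + conj δ + 1; - i θ)`. -/
def pCirc (δ : ℂ) (θ : ℝ) : ℂ :=
  ((|θ| ^ δ.re : ℝ) : ℂ) *
    Complex.exp (Complex.I * θ / 2 - ((π / 2 * δ.im * Real.sign θ : ℝ) : ℂ)) *
    hyp1F1 δ (δ + conj δ + 1) (-Complex.I * θ)

/-- The corresponding function on the real line: `|2 / x| ^ Re δ *
e ^ (- i / x + (π / 2) Im δ sgn x) * ₁F₁(δ; δ + conj δ + 1; 2 i / x)`. -/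
def pReal (δ : ℂ) (x : ℝ) : ℂ :=
  ((|2 / x| ^ δ.re : ℝ) : ℂ) *
    Complex.exp (-Complex.I / x + ((π / 2 * δ.im * Real.sign x : ℝ) : ℂ)) *
    hyp1F1 δ (δ + conj δ + 1) (2 * Complex.I / x)

/-- The limiting kernel off the diagonal. -/
def limKernelOff (δ : ℂ) (θ τ : ℝ) : ℂ :=
  1 / (2 * Complex.I * π) * (gammaFactor δ : ℂ) *
    ((pCirc δ θ * conj (pCirc δ τ) - conj (pCirc δ θ) * pCirc δ τ) / ((θ : ℂ) - τ))

/-- The limiting kernel on the diagonal. -/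
def limKernelDiag (δ : ℂ) (θ : ℝ) : ℝ :=
  |θ| ^ (2 * δ.re) * Real.exp (-(π * δ.im * Real.sign θ)) / (2 * π) * gammaFactor δ *
    (hyp1F1 δ (δ + conj δ + 1) (-Complex.I * θ) *
      (hyp1F1 (conj δ) (δ + conj δ + 1) (Complex.I * θ) -
        2 * (conj δ / (δ + conj δ + 1)) *
          hyp1F1 (conj δ + 1) (δ + conj δ + 2) (Complex.I * θ))).re

/-- The limiting (confluent hypergeometric) kernel. -/
def limKernel (δ : ℂ) (θ τ : ℝ) : ℂ :=
  open Classical in if θ = τ then (limKernelDiag δ θ : ℂ) else limKernelOff δ θ τ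

/-- The angles considered: all real numbers if the weight is continuous at `z = 1`
(that is, `δ = 0` or `Re δ > 0`), and all non-zero real numbers otherwise. -/
def Admissible (δ : ℂ) (θ : ℝ) : Prop := δ = 0 ∨ 0 < δ.re ∨ θ ≠ 0

end

end CircularJacobi

namespace CircularJacobi

noncomputable section

/-! ### The weight in angular form, and its moments -/

/-! The weight has a single Fisher–Hartwig singularity, at `z = 1`, and everything attached to it is
explicit. On `(0, 2π)` the principal powers collapse to `arcWeight`, and integrating the derivative
of `e^{ikθ} (1 - e^{iθ}) w` gives a two-term recursion for the moments (`moment_succ`), so all of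
them are reciprocal Gamma products (`moment_neg`). The remaining constant, the total mass, comes
from an invariance under `δ ↦ δ + 1` together with concentration at `θ = π` as the shift grows
(`mass_eq`).

Up to constants the orthogonal polynomials are `₂F₁(-n, conj δ + 1; 1 + δ + conj δ; 1 - z)`
(`fPoly`) and the reversed ones have `conj δ` as second parameter (`gPoly`). Contiguous relations
between these are the Szegő recursion. That recursion does three things: it propagates a closed
formula for `∫ z⁻ʲ p w`, whose zeros in `j` are the orthogonality (`pairing_poly`); it shows that
`f` is the reversal of `g` on the circle (`fPoly_eq_reverse`); and it multiplies the form `conj g g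
- conj z ζ conj f f` by a scalar, which is the Christoffel–Darboux formula (`christoffelDarboux`).
Uniqueness in Gram–Schmidt (`monicOP_unique`) ties these polynomials to the given orthonormal ones.

At `z = e^{iθ/n}` one has `n (z - 1) → iθ`, and the `₂F₁` degenerate termwise to `₁F₁`
(`tendsto_hypPoly`). The weight and the squared norms both scale like `n ^ (-2 Re δ)`, so these
powers cancel, and the value of the mass turns the constant into `G(δ) / 2π`. Off the diagonal one
divides Christoffel–Darboux by `1 - conj z ζ`; on the diagonal one differentiates it.

For the correlations, the squared Vandermonde determinant is a multiple of the kernel determinant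
(`jointWeight_eq`), and integrating one variable out of the determinant of a reproducing kernel of
trace `n` only produces a scalar (`integral_kdet_snoc`). Hence `corr` is exactly a determinant
(`corr_eq`) and its limit is taken entrywise, the phases disappearing by diagonal conjugation. That
`corr` is a joint intensity is permutation symmetry plus Fubini (`isJointIntensity_corr`). -/

/-- The weight as a function of the angle in `(0, 2π)`. -/
def arcWeight (δ : ℂ) (θ : ℝ) : ℝ :=
  (2 * Real.sin (θ / 2)) ^ (2 * δ.re) * Real.exp (δ.im * (θ - π))

lemma sin_half_pos {θ : ℝ} (h0 : 0 < θ) (h1 : θ < 2 * π) : 0 < 2 * Real.sin (θ / 2) := by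
  have := Real.sin_pos_of_pos_of_lt_pi (x := θ / 2) (by linarith) (by linarith)
  linarith

lemma one_sub_circPt (θ : ℝ) :
    1 - circPt θ = ((2 * Real.sin (θ / 2) : ℝ) : ℂ) * Complex.exp (Complex.I * ((θ - π) / 2)) := by
  have e1 : Complex.exp (Complex.I * ((θ - π) / 2)) = Complex.exp (Complex.I * θ / 2) * -Complex.I := by
    rw [show Complex.I * (((θ : ℂ) - π) / 2) = Complex.I * θ / 2 + -(π / 2 * Complex.I) by ring,
      Complex.exp_add, Complex.exp_neg, Complex.exp_pi_div_two_mul_I, Complex.inv_I]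
  have e2 : Complex.exp (Complex.I * θ) = Complex.exp (Complex.I * θ / 2) ^ 2 := by
    rw [← Complex.exp_nat_mul]; congr 1; push_cast; ring
  have e3 : Complex.exp (-(Complex.I * θ / 2)) * Complex.exp (Complex.I * θ / 2) = 1 := by
    rw [← Complex.exp_add]; simp
  rw [circPt, e1, e2]
  push_cast
  rw [Complex.sin, show -((θ : ℂ) / 2) * Complex.I = -(Complex.I * θ / 2) by ring,
    show ((θ : ℂ) / 2) * Complex.I = (Complex.I * θ / 2) by ring]
  linear_combination -(1 : ℂ) * e3 + (Complex.exp (-(Complex.I * θ / 2)) -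
    Complex.exp (Complex.I * θ / 2)) * Complex.exp (Complex.I * θ / 2) * Complex.I_sq

lemma circPt_inv (θ : ℝ) : (circPt θ)⁻¹ = conj (circPt θ) := by
  rw [circPt, ← Complex.exp_neg, ← Complex.exp_conj]; simp

lemma norm_circPt (θ : ℝ) : ‖circPt θ‖ = 1 := by
  rw [circPt, mul_comm, Complex.norm_exp_ofReal_mul_I]

lemma continuous_circPt : Continuous circPt := by unfold circPt; fun_prop

lemma circPt_add_two_pi (θ : ℝ) : circPt (θ + 2 * π) = circPt θ := by
  rw [circPt, circPt]; push_cast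
  rw [mul_add, Complex.exp_add, show Complex.I * (2 * (π : ℂ)) = 2 * π * Complex.I by ring,
    Complex.exp_two_pi_mul_I, mul_one]

/-- The factor `1 - e^{iθ}` has modulus `s = 2 sin(θ/2)` and argument `φ = (θ - π)/2` in `(-π/2,
π/2)`, so its principal logarithm is `log s + iφ`. The exponents add up to `2 Re δ log s + 2 Im δ
φ`, which is real. -/
lemma weight_circPt (δ : ℂ) {θ : ℝ} (h0 : 0 < θ) (h1 : θ < 2 * π) :
    weight δ (circPt θ) = arcWeight δ θ := by
  have hs := sin_half_pos h0 h1
  have hpi := Real.pi_pos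
  set s : ℝ := 2 * Real.sin (θ / 2) with hsdef
  have hlog : ((Real.log s : ℝ) : ℂ) = Complex.log s := Complex.ofReal_log hs.le
  have hsexp : (s : ℂ) = Complex.exp (Real.log s : ℝ) := by
    rw [hlog, Complex.exp_log (by exact_mod_cast hs.ne')]
  have hz : 1 - circPt θ = Complex.exp ((Real.log s : ℝ) + (((θ - π) / 2 : ℝ) : ℂ) * Complex.I) := by
    rw [one_sub_circPt, ← hsdef, Complex.exp_add, ← hsexp]
    congr 2; push_cast; ring
  have hz' : 1 - (circPt θ)⁻¹ =
      Complex.exp ((Real.log s : ℝ) + ((-((θ - π) / 2) : ℝ) : ℂ) * Complex.I) := by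
    rw [circPt_inv, ← map_one (starRingEnd ℂ), ← map_sub, hz, ← Complex.exp_conj]
    congr 1
    rw [map_add, map_mul, Complex.conj_ofReal, Complex.conj_ofReal, Complex.conj_I]
    push_cast; ring
  have l1 : Complex.log (1 - circPt θ) =
      (Real.log s : ℝ) + (((θ - π) / 2 : ℝ) : ℂ) * Complex.I := by
    rw [hz, Complex.log_exp]
    · simp only [Complex.add_im, Complex.ofReal_im, Complex.im_ofReal_mul, Complex.I_im]; linarith
    · simp only [Complex.add_im, Complex.ofReal_im, Complex.im_ofReal_mul, Complex.I_im]; linarith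
  have l2 : Complex.log (1 - (circPt θ)⁻¹) =
      (Real.log s : ℝ) + ((-((θ - π) / 2) : ℝ) : ℂ) * Complex.I := by
    rw [hz', Complex.log_exp]
    · simp only [Complex.add_im, Complex.ofReal_im, Complex.im_ofReal_mul, Complex.I_im]; linarith
    · simp only [Complex.add_im, Complex.ofReal_im, Complex.im_ofReal_mul, Complex.I_im]; linarith
  rw [weight, Complex.cpow_def_of_ne_zero (by rw [hz]; exact Complex.exp_ne_zero _),
    Complex.cpow_def_of_ne_zero (by rw [hz']; exact Complex.exp_ne_zero _), l1, l2,
    ← Complex.exp_add, arcWeight, ← hsdef, Real.rpow_def_of_pos hs, ← Real.exp_add,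
    ← Complex.ofReal_re (Real.exp _), Complex.ofReal_exp]
  congr 2
  apply Complex.ext
  · simp; ring
  · simp; ring

/-- Depends on the conventions `0 ^ 0 = 1` and `0 ^ a = 0` for every other complex `a`, even one
with non-positive real part. Integrals do not see this point; the scaling limit at angle `0` does.
-/
lemma weight_one (δ : ℂ) : weight δ 1 = if δ = 0 then 1 else 0 := by
  by_cases h : δ = 0 <;> simp [weight, h]

lemma arcWeight_pos (δ : ℂ) {θ : ℝ} (h0 : 0 < θ) (h1 : θ < 2 * π) : 0 < arcWeight δ θ :=
  mul_pos (Real.rpow_pos_of_pos (sin_half_pos h0 h1) _) (Real.exp_pos _)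

lemma weight_periodic (δ : ℂ) : Function.Periodic (fun θ => weight δ (circPt θ)) (2 * π) :=
  fun θ => by simp only [circPt_add_two_pi]

lemma weight_circPt_nonneg (δ : ℂ) (θ : ℝ) : 0 ≤ weight δ (circPt θ) := by
  obtain ⟨y, hy, h⟩ := (weight_periodic δ).exists_mem_Ico₀ (by positivity) θ
  rw [h]
  rcases eq_or_lt_of_le hy.1 with h0 | h0
  · rw [← h0]
    have : circPt 0 = 1 := by simp [circPt]
    rw [this, weight_one]; split_ifs <;> norm_num
  · rw [weight_circPt δ h0 hy.2]; exact (arcWeight_pos δ h0 hy.2).le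

lemma weight_circPt_of_neg (δ : ℂ) {θ : ℝ} (h0 : -(2 * π) < θ) (h1 : θ < 0) :
    weight δ (circPt θ) = arcWeight δ (θ + 2 * π) := by
  rw [← weight_circPt δ (by linarith) (by linarith), circPt_add_two_pi]

lemma measurable_weight (δ : ℂ) : Measurable (fun θ => weight δ (circPt θ)) := by
  have hc : Measurable circPt := continuous_circPt.measurable
  unfold weight
  exact Complex.measurable_re.comp
    (((measurable_const.sub hc).pow_const _).mul ((measurable_const.sub hc.inv).pow_const _))

/-- Only negative exponents matter. On `(0, π]` Jordan's inequality gives `2 sin(θ/2) ≥ (2/π) θ`,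
and `θ ^ (2 Re δ)` is integrable since `2 Re δ > -1`; the other half follows by reflection in `π`.
-/
lemma intervalIntegrable_arcWeight {δ : ℂ} (hδ : -(1 / 2 : ℝ) < δ.re) :
    IntervalIntegrable (arcWeight δ) volume 0 (2 * π) := by
  have hpi := Real.pi_pos
  have key : IntervalIntegrable (fun θ => (2 * Real.sin (θ / 2)) ^ (2 * δ.re)) volume 0 π := by
    by_cases ha : 0 ≤ δ.re
    · apply Continuous.intervalIntegrable
      exact Continuous.rpow_const (by fun_prop) fun _ => Or.inr (by positivity)
    · push Not at ha
      have h1 : IntervalIntegrable (fun θ : ℝ => (2 / π) ^ (2 * δ.re) * θ ^ (2 * δ.re)) volume 0 π :=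
        (intervalIntegral.intervalIntegrable_rpow' (by linarith)).const_mul _
      refine h1.mono_fun' ?_ ?_
      · exact ((by fun_prop : Measurable fun θ : ℝ => 2 * Real.sin (θ / 2)).pow_const
          _).aestronglyMeasurable
      · rw [Filter.EventuallyLE, ae_restrict_iff' measurableSet_uIoc]
        refine Eventually.of_forall fun x hx => ?_
        rw [Set.uIoc_of_le hpi.le] at hx
        have h2 := Real.mul_le_sin (x := x / 2) (by linarith [hx.1]) (by linarith [hx.2])
        have hx1 := hx.1
        have h3 : 0 < 2 / π * x := by positivity
        have h4 : 2 / π * x ≤ 2 * Real.sin (x / 2) := by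
          have : 2 / π * (x / 2) * 2 = 2 / π * x := by ring
          linarith
        rw [Real.norm_of_nonneg (Real.rpow_nonneg (by linarith) _),
          ← Real.mul_rpow (by positivity) hx.1.le]
        exact Real.rpow_le_rpow_of_nonpos h3 h4 (by linarith)
  have key2 : IntervalIntegrable (fun θ => (2 * Real.sin (θ / 2)) ^ (2 * δ.re)) volume π (2 * π) := by
    have := (key.comp_sub_left (2 * π)).symm
    simp only [sub_zero] at this
    rw [show 2 * π - π = π by ring] at this
    refine this.congr fun x _ => ?_
    rw [show (2 * π - x) / 2 = π - x / 2 by ring, Real.sin_pi_sub]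
  exact (key.trans key2).mul_continuousOn (by fun_prop)

lemma intervalIntegrable_weight {δ : ℂ} (hδ : -(1 / 2 : ℝ) < δ.re) (a b : ℝ) :
    IntervalIntegrable (fun θ => weight δ (circPt θ)) volume a b := by
  refine (weight_periodic δ).intervalIntegrable₀ (by positivity) ?_ a b
  refine (intervalIntegrable_arcWeight hδ).congr_ae ?_
  rw [Filter.EventuallyEq, ae_restrict_iff' measurableSet_uIoc]
  filter_upwards [compl_mem_ae_iff.2 (measure_singleton (2 * π))] with x hx hx'
  rw [Set.uIoc_of_le (by positivity)] at hx'
  exact (weight_circPt δ hx'.1 (lt_of_le_of_ne hx'.2 hx)).symm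

/-- Moves the period to `(0, 2π)`, so that the singularity sits at the end points and one formula
for the weight is valid throughout. -/
lemma integral_weight_mul {δ : ℂ} {F : ℝ → ℂ} (hF : Function.Periodic F (2 * π)) :
    ∫ θ in (-π)..π, F θ * (weight δ (circPt θ) : ℂ) =
      ∫ θ in (0)..(2 * π), F θ * (arcWeight δ θ : ℂ) := by
  have hp : Function.Periodic (fun θ => F θ * (weight δ (circPt θ) : ℂ)) (2 * π) := fun θ => by
    simp only [hF θ, circPt_add_two_pi]
  have := hp.intervalIntegral_add_eq (-π) 0
  rw [show -π + 2 * π = π by ring, zero_add] at this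
  rw [this]
  apply intervalIntegral.integral_congr_ae
  filter_upwards [compl_mem_ae_iff.2 (measure_singleton (2 * π))] with x hx hx'
  rw [Set.uIoc_of_le (by positivity)] at hx'
  rw [weight_circPt δ hx'.1 (lt_of_le_of_ne hx'.2 hx)]

/-- The moments `∫ e ^ (i k θ) w`. -/
def moment (δ : ℂ) (k : ℤ) : ℂ :=
  ∫ θ in (0)..(2 * π), Complex.exp (Complex.I * (k * θ)) * (arcWeight δ θ : ℂ)

/-- The total mass of the weight. -/
def mass (δ : ℂ) : ℝ := ∫ θ in (0)..(2 * π), arcWeight δ θ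

lemma intervalIntegrable_mul_arcWeight {δ : ℂ} (hδ : -(1 / 2 : ℝ) < δ.re) {F : ℝ → ℂ}
    (hF : Continuous F) :
    IntervalIntegrable (fun θ => F θ * (arcWeight δ θ : ℂ)) volume 0 (2 * π) :=
  IntervalIntegrable.continuousOn_mul
    (Complex.ofRealCLM.integrable_comp (intervalIntegrable_arcWeight hδ).1 |> fun h =>
      ⟨h, Complex.ofRealCLM.integrable_comp (intervalIntegrable_arcWeight hδ).2⟩) hF.continuousOn

lemma moment_zero (δ : ℂ) : moment δ 0 = mass δ := by
  simp only [moment, mass, Int.cast_zero, zero_mul, mul_zero, Complex.exp_zero, one_mul]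
  exact intervalIntegral.integral_ofReal

/-- The integral of an exact derivative that vanishes at both ends of the period. This recursion is
the only analytic input about the moments. -/
lemma moment_succ {δ : ℂ} (hδ : -(1 / 2 : ℝ) < δ.re) (k : ℤ) :
    (k + 1 + conj δ) * moment δ (k + 1) = (k - δ) * moment δ k := by
  have hpi := Real.pi_pos
  -- This is `i e^{ikθ} (1 - e^{iθ}) w`: the extra factor `1 - e^{iθ}` raises the exponent of the
  -- sine to `2 Re δ + 1 > 0`, which makes `F` continuous and zero at `0` and `2π`.
  set F : ℝ → ℂ := fun θ => (((2 * Real.sin (θ / 2)) ^ (2 * δ.re + 1) *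
    Real.exp (δ.im * (θ - π)) : ℝ) : ℂ) * Complex.exp (Complex.I * ((k + 1 / 2) * θ)) with hFdef
  have hcont : Continuous F := by
    refine Continuous.mul (Complex.continuous_ofReal.comp (Continuous.mul ?_ (by fun_prop)))
      (by fun_prop)
    exact Continuous.rpow_const (by fun_prop) fun _ => Or.inr (by linarith)
  have hderiv : ∀ θ ∈ Set.Ioo 0 (2 * π), HasDerivAt F
      ((k + 1 + conj δ) * (Complex.exp (Complex.I * (((k + 1 : ℤ) : ℂ) * θ)) * (arcWeight δ θ : ℂ)) -
        (k - δ) * (Complex.exp (Complex.I * (k * θ)) * (arcWeight δ θ : ℂ))) θ := by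
    intro θ hθ
    have hs := sin_half_pos hθ.1 hθ.2
    have d1 : HasDerivAt (fun θ : ℝ => 2 * Real.sin (θ / 2)) (Real.cos (θ / 2)) θ := by
      have := ((Real.hasDerivAt_sin (θ / 2)).comp θ ((hasDerivAt_id θ).div_const 2)).const_mul 2
      refine this.congr_deriv ?_
      ring
    have d2 := d1.rpow_const (p := 2 * δ.re + 1) (Or.inl hs.ne')
    have d3 : HasDerivAt (fun θ : ℝ => Real.exp (δ.im * (θ - π)))
        (Real.exp (δ.im * (θ - π)) * δ.im) θ := by
      have := (((hasDerivAt_id θ).sub_const π).const_mul δ.im).exp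
      simpa using this
    have d4 : HasDerivAt (fun θ : ℝ => Complex.exp (Complex.I * ((k + 1 / 2) * θ)))
        (Complex.exp (Complex.I * ((k + 1 / 2) * θ)) * (Complex.I * (k + 1 / 2))) θ := by
      have := (((hasDerivAt_id θ).ofReal_comp.const_mul ((k : ℂ) + 1 / 2)).const_mul Complex.I).cexp
      simpa using this
    have d5 := ((d2.mul d3).ofReal_comp).mul d4
    refine d5.congr_deriv ?_
    simp only [Pi.mul_apply]
    rw [show 2 * δ.re + 1 - 1 = 2 * δ.re by ring, Real.rpow_add_one hs.ne', arcWeight]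
    set h := Complex.exp (Complex.I * θ / 2) with hh
    set h' := Complex.exp (-(Complex.I * θ / 2)) with hh'
    have hhh : h' * h = 1 := by rw [hh, hh', ← Complex.exp_add]; simp
    have e1 : Complex.exp (Complex.I * (((k + 1 : ℤ) : ℂ) * θ)) =
        Complex.exp (Complex.I * (k * θ)) * h ^ 2 := by
      rw [hh, ← Complex.exp_nat_mul, ← Complex.exp_add]; congr 1; push_cast; ring
    have e2 : Complex.exp (Complex.I * ((k + 1 / 2) * θ)) =
        Complex.exp (Complex.I * (k * θ)) * h := by
      rw [hh, ← Complex.exp_add]; congr 1; ring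
    have e3 : ((Real.cos (θ / 2) : ℝ) : ℂ) = (h + h') / 2 := by
      rw [Complex.ofReal_cos, Complex.cos, hh, hh']; push_cast
      rw [show -((θ : ℂ) / 2) * Complex.I = -(Complex.I * θ / 2) by ring,
        show ((θ : ℂ) / 2) * Complex.I = (Complex.I * θ / 2) by ring]
    have e4 : ((2 * Real.sin (θ / 2) : ℝ) : ℂ) = (h' - h) * Complex.I := by
      push_cast
      rw [Complex.sin, hh, hh']
      rw [show -((θ : ℂ) / 2) * Complex.I = -(Complex.I * θ / 2) by ring,
        show ((θ : ℂ) / 2) * Complex.I = (Complex.I * θ / 2) by ring]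
      ring
    have e5 : conj δ = δ.re - δ.im * Complex.I := by
      apply Complex.ext <;> simp
    have e6 : δ = δ.re + δ.im * Complex.I := (Complex.re_add_im δ).symm
    have e7 : 2 * Complex.sin ((θ : ℂ) / 2) = (h' - h) * Complex.I := by
      rw [← e4]; push_cast; rfl
    rw [e1, e2, e5]
    conv_rhs => rw [e6]
    simp only [Complex.add_re, Complex.add_im, Complex.mul_re, Complex.mul_im, Complex.ofReal_re,
      Complex.ofReal_im, Complex.I_re, Complex.I_im, mul_zero, mul_one, add_zero, zero_add,
      sub_zero]
    rw [Complex.ofReal_add, Complex.ofReal_mul, Complex.ofReal_mul, Complex.ofReal_mul, e3,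
      Complex.ofReal_mul, Complex.ofReal_mul, Complex.ofReal_mul, Complex.ofReal_mul,
      Complex.ofReal_mul, Complex.ofReal_mul, e4]
    push_cast
    generalize (((2 * Real.sin (θ / 2)) ^ (2 * δ.re) : ℝ) : ℂ) = S
    generalize Complex.exp (δ.im * (θ - π)) = T
    generalize Complex.exp (Complex.I * (k * θ)) = U
    have hI := Complex.I_sq
    linear_combination (S * T * U) * (((2 * δ.re + 1) / 2) + Complex.I * δ.im -
      k - 1/2) * hhh + S * T * U * (h' - h) * h * (k + 1/2) * hI +
      h * S * T * δ.im * U * e7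
  have hi1 := (intervalIntegrable_mul_arcWeight hδ
    (F := fun θ => Complex.exp (Complex.I * (((k + 1 : ℤ) : ℂ) * θ))) (by fun_prop)).const_mul
      (k + 1 + conj δ)
  have hi2 := (intervalIntegrable_mul_arcWeight hδ
    (F := fun θ => Complex.exp (Complex.I * (k * θ))) (by fun_prop)).const_mul (k - δ)
  have := intervalIntegral.integral_eq_sub_of_hasDerivAt_of_le (by positivity) hcont.continuousOn
    hderiv (hi1.sub hi2)
  rw [intervalIntegral.integral_sub hi1 hi2, intervalIntegral.integral_const_mul,
    intervalIntegral.integral_const_mul] at this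
  have h0 : F (2 * π) - F 0 = 0 := by
    simp only [hFdef]
    rw [show 2 * π / 2 = π by ring]
    simp [Real.zero_rpow (show 2 * δ.re + 1 ≠ 0 by linarith)]
  rw [h0, sub_eq_zero] at this
  exact this

/-! ### Evaluation of the total mass by Gamma functions -/

lemma re_ne_zero_imp {z : ℂ} (h : z.re ≠ 0) : z ≠ 0 := fun h0 => h (by simp [h0])

/-- Raising `δ` by one multiplies the weight by `|1 - z| ^ 2 = 2 - z - z⁻¹`, so the new mass is `2
m₀ - m₁ - m₋₁`; the moment recursion at `k = 0` and `k = -1` expresses both neighbours through `m₀`.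
-/
lemma mass_add_one {δ : ℂ} (hδ : -(1 / 2 : ℝ) < δ.re) :
    ‖1 + δ‖ ^ 2 * mass (δ + 1) = (2 * δ.re + 1) * (2 * δ.re + 2) * mass δ := by
  have h1 : (1 + δ : ℂ) ≠ 0 := re_ne_zero_imp (by simp; linarith)
  have h1' : (1 + conj δ : ℂ) ≠ 0 := re_ne_zero_imp (by simp; linarith)
  have m1 := moment_succ hδ 0
  have m2 := moment_succ hδ (-1)
  simp only [zero_add, Int.cast_zero, zero_sub, Int.cast_neg, Int.cast_one, neg_add_cancel,
    moment_zero] at m1 m2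
  have key : (mass (δ + 1) : ℂ) = 2 * moment δ 0 - moment δ 1 - moment δ (-1) := by
    have hi : ∀ k : ℤ, IntervalIntegrable (fun θ : ℝ => Complex.exp (Complex.I * (k * θ)) *
        (arcWeight δ θ : ℂ)) volume 0 (2 * π) := fun k =>
      intervalIntegrable_mul_arcWeight hδ (by fun_prop)
    rw [mass, ← intervalIntegral.integral_ofReal, moment, moment, moment,
      ← intervalIntegral.integral_const_mul,
      ← intervalIntegral.integral_sub ((hi 0).const_mul 2) (hi 1),
      ← intervalIntegral.integral_sub (((hi 0).const_mul 2).sub (hi 1)) (hi (-1))]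
    apply intervalIntegral.integral_congr_ae
    filter_upwards [compl_mem_ae_iff.2 (measure_singleton (2 * π))] with θ hx hx'
    rw [Set.uIoc_of_le (by positivity)] at hx'
    have hs := sin_half_pos hx'.1 (lt_of_le_of_ne hx'.2 hx)
    have e1 : arcWeight (δ + 1) θ = (2 * Real.sin (θ / 2)) ^ 2 * arcWeight δ θ := by
      rw [arcWeight, arcWeight, ← Real.rpow_natCast, ← mul_assoc, ← Real.rpow_add hs]
      simp only [Complex.add_re, Complex.one_re, Complex.add_im, Complex.one_im, add_zero]
      congr 2; push_cast; ring
    have e2 : (2 * Real.sin (θ / 2)) ^ 2 = 2 - 2 * Real.cos θ := by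
      have h2 := Real.cos_two_mul (θ / 2)
      have h3 := Real.sin_sq (θ / 2)
      rw [show 2 * (θ / 2) = θ by ring] at h2
      rw [mul_pow, h3, h2]; ring
    rw [e1, e2]
    push_cast
    rw [Complex.cos]
    simp only [Complex.exp_zero, mul_zero, zero_mul, neg_mul, one_mul, mul_neg]
    rw [mul_comm (θ : ℂ) Complex.I]
    ring
  rw [moment_zero] at key
  have hre : ((2 * δ.re : ℝ) : ℂ) = δ + conj δ := by
    rw [Complex.add_conj]
  apply Complex.ofReal_injective
  push_cast
  push_cast at hre
  rw [hre, ← Complex.mul_conj', map_add, map_one, key]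
  linear_combination -(1 + δ) * m1 - (1 + conj δ) * m2

lemma mass_pos {δ : ℂ} (hδ : -(1 / 2 : ℝ) < δ.re) : 0 < mass δ :=
  intervalIntegral.intervalIntegral_pos_of_pos_on (intervalIntegrable_arcWeight hδ)
    (fun _ hx => arcWeight_pos δ hx.1 hx.2) (by positivity)

lemma Gamma_add_nat {s : ℂ} (hs : 0 < s.re) (n : ℕ) :
    Complex.Gamma (s + n) = (∏ j ∈ Finset.range n, (s + j)) * Complex.Gamma s := by
  induction n with
  | zero => simp
  | succ n ih =>
    rw [Finset.prod_range_succ, mul_right_comm, ← ih, Nat.cast_succ, ← add_assoc,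
      Complex.Gamma_add_one _ (re_ne_zero_imp (by simp; positivity)), mul_comm]

/-- Euler's limit formula, rearranged: `Γ(s + n) ~ n ^ (s - 1) n!`. Moduli suffice because only
`|Γ(1 + δ)| ^ 2` enters the mass. -/
lemma tendsto_norm_Gamma_add_nat {s : ℂ} (hs : 0 < s.re) :
    Tendsto (fun n : ℕ => ‖Complex.Gamma (s + n)‖ / ((n : ℝ) ^ (s.re - 1) * n !)) atTop (𝓝 1) := by
  have hG : Complex.Gamma s ≠ 0 := Complex.Gamma_ne_zero_of_re_pos hs
  have h1 : Tendsto (fun n : ℕ => ‖Complex.Gamma s / Complex.GammaSeq s n‖) atTop (𝓝 1) := by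
    have := ((tendsto_const_nhds (x := Complex.Gamma s)).div
      (Complex.GammaSeq_tendsto_Gamma s) hG).norm
    rwa [div_self hG, norm_one] at this
  have h2 : Tendsto (fun n : ℕ => ‖((n : ℂ) / (n + s))‖) atTop (𝓝 1) := by
    have := (tendsto_natCast_div_add_atTop (𝕜 := ℂ) s).norm
    simpa using this
  have h3 := h1.mul h2
  rw [mul_one] at h3
  refine h3.congr' ?_
  filter_upwards [eventually_gt_atTop 0] with n hn
  have hn' : (0 : ℝ) < n := by exact_mod_cast hn
  have hp : (∏ j ∈ Finset.range n, (s + j)) ≠ 0 :=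
    Finset.prod_ne_zero_iff.2 fun j _ => re_ne_zero_imp (by simp; positivity)
  have hsn : s + n ≠ 0 := re_ne_zero_imp (by simp; positivity)
  rw [← norm_mul, Gamma_add_nat hs, Complex.GammaSeq, Finset.prod_range_succ,
    Real.rpow_sub_one hn'.ne', ← Complex.norm_natCast_cpow_of_pos hn]
  have : (n : ℝ) = ‖(n : ℂ)‖ := by simp
  have h4 : ((n ! : ℕ) : ℝ) = ‖((n ! : ℕ) : ℂ)‖ := by simp
  rw [this, h4, ← norm_div, ← norm_mul, ← norm_div]
  congr 1
  have hnc : (n : ℂ) ≠ 0 := by exact_mod_cast hn.ne'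
  have hf : ((n ! : ℕ) : ℂ) ≠ 0 := by exact_mod_cast n.factorial_ne_zero
  have hc : (n : ℂ) ^ s ≠ 0 := by simp [Complex.cpow_eq_zero_iff, hnc]
  rw [add_comm (n : ℂ) s]
  field_simp

lemma tendsto_Gamma_add_nat {s : ℝ} (hs : 0 < s) :
    Tendsto (fun n : ℕ => Real.Gamma (s + n) / ((n : ℝ) ^ (s - 1) * n !)) atTop (𝓝 1) := by
  refine (tendsto_norm_Gamma_add_nat (s := s) (by simpa)).congr fun n => ?_
  rw [Complex.ofReal_re, ← Complex.ofReal_natCast, ← Complex.ofReal_add, Complex.Gamma_ofReal,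
    Complex.norm_real, Real.norm_of_nonneg (Real.Gamma_pos_of_pos (by positivity)).le]

lemma integral_Icc_sin_pow_mul (δ : ℂ) (n : ℕ) :
    ∫ θ in Set.Icc 0 (2 * π), ((2 * Real.sin (θ / 2)) ^ 2) ^ n * arcWeight δ θ = mass (δ + n) := by
  rw [mass, intervalIntegral.integral_of_le (by positivity), integral_Icc_eq_integral_Ioo,
    integral_Ioc_eq_integral_Ioo]
  refine setIntegral_congr_fun measurableSet_Ioo fun θ hθ => ?_
  have hs := sin_half_pos hθ.1 hθ.2
  simp only [arcWeight]
  rw [← pow_mul, ← Real.rpow_natCast, ← mul_assoc, ← Real.rpow_add hs]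
  simp only [Complex.add_re, Complex.natCast_re, Complex.add_im, Complex.natCast_im, add_zero]
  congr 2; push_cast; ring

/-- The masses at `δ + n` and at `n` are integrals of `(4 sin²(θ/2)) ^ n` with and without the
factor `arcWeight δ`. These powers concentrate at their unique maximum `θ = π`, so the ratio tends
to `arcWeight δ π`. -/
lemma tendsto_mass_div {δ : ℂ} (hδ : -(1 / 2 : ℝ) < δ.re) :
    Tendsto (fun n : ℕ => (mass n)⁻¹ * mass (δ + n)) atTop (𝓝 (2 ^ (2 * δ.re))) := by
  have hpi := Real.pi_pos
  have h := tendsto_setIntegral_pow_smul_of_unique_maximum_of_isCompact_of_integrableOn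
    (μ := volume) (s := Set.Icc 0 (2 * π)) (x₀ := π) (c := fun θ => (2 * Real.sin (θ / 2)) ^ 2)
    (g := arcWeight δ) isCompact_Icc (by fun_prop) ?_ (fun x _ => by positivity)
    (by simp) ?_ ?_ ?_
  · have e : arcWeight δ π = 2 ^ (2 * δ.re) := by simp [arcWeight]
    rw [e] at h
    refine h.congr fun n => ?_
    have e2 := integral_Icc_sin_pow_mul 0 n
    have e3 : ∀ θ, arcWeight 0 θ = 1 := fun θ => by simp [arcWeight]
    simp only [e3, mul_one, zero_add] at e2
    rw [e2]
    simp only [smul_eq_mul]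
    rw [integral_Icc_sin_pow_mul]
  · intro y hy hne
    have h0 : 0 ≤ Real.sin (y / 2) :=
      Real.sin_nonneg_of_nonneg_of_le_pi (by linarith [hy.1]) (by linarith [hy.2])
    have h1 : Real.sin (y / 2) < 1 := by
      refine lt_of_le_of_ne (Real.sin_le_one _) fun h => hne ?_
      have hc : Real.cos (y / 2) = 0 := by
        have := Real.sin_sq_add_cos_sq (y / 2)
        rw [h] at this
        nlinarith
      by_contra hy'
      rcases lt_or_gt_of_ne hy' with h2 | h2
      · exact (Real.cos_pos_of_mem_Ioo ⟨by linarith [hy.1], by linarith⟩).ne' hc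
      · exact (Real.cos_neg_of_pi_div_two_lt_of_lt (by linarith) (by linarith [hy.2])).ne hc
    simp only [Real.sin_pi_div_two]
    exact pow_lt_pow_left₀ (by linarith) (by linarith) two_ne_zero
  · rw [interior_Icc, closure_Ioo (by positivity)]
    exact ⟨by linarith, by linarith⟩
  · exact (intervalIntegrable_iff_integrableOn_Icc_of_le (by positivity)).1
      (intervalIntegrable_arcWeight hδ)
  · refine ContinuousAt.continuousWithinAt ?_
    unfold arcWeight
    refine ContinuousAt.mul (ContinuousAt.rpow_const (by fun_prop) (Or.inl (by simp))) (by fun_prop)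

lemma Gamma_add_two {x : ℝ} (hx : 0 < x) : Real.Gamma (x + 2) = (x + 1) * x * Real.Gamma x := by
  rw [show x + 2 = (x + 1) + 1 by ring, Real.Gamma_add_one (by positivity),
    Real.Gamma_add_one hx.ne', mul_assoc]

/-- The functional equation of `Γ` absorbs the factors of `mass_add_one`, leaving a quantity
invariant under `δ ↦ δ + 1`. Its value can therefore be read off at infinity. -/
lemma mass_mul_Gamma_add_one {δ : ℂ} (hδ : -(1 / 2 : ℝ) < δ.re) :
    mass (δ + 1) * ‖Complex.Gamma (1 + (δ + 1))‖ ^ 2 / Real.Gamma (1 + 2 * (δ + 1).re) =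
      mass δ * ‖Complex.Gamma (1 + δ)‖ ^ 2 / Real.Gamma (1 + 2 * δ.re) := by
  have h1 : (1 + δ : ℂ) ≠ 0 := re_ne_zero_imp (by simp; linarith)
  have hC : 0 < 1 + 2 * δ.re := by linarith
  have hG := Real.Gamma_pos_of_pos hC
  rw [← add_assoc, Complex.Gamma_add_one _ h1, norm_mul, Complex.add_re, Complex.one_re,
    show 1 + 2 * (δ.re + 1) = 1 + 2 * δ.re + 2 by ring, Gamma_add_two hC]
  have := mass_add_one hδ
  rw [div_eq_div_iff (by positivity) hG.ne']
  linear_combination (‖Complex.Gamma (1 + δ)‖ ^ 2 * Real.Gamma (1 + 2 * δ.re)) * this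

lemma mass_mul_Gamma_add_nat {δ : ℂ} (hδ : -(1 / 2 : ℝ) < δ.re) (n : ℕ) :
    mass (δ + n) * ‖Complex.Gamma (1 + (δ + n))‖ ^ 2 / Real.Gamma (1 + 2 * (δ + n).re) =
      mass δ * ‖Complex.Gamma (1 + δ)‖ ^ 2 / Real.Gamma (1 + 2 * δ.re) := by
  induction n with
  | zero => simp
  | succ n ih =>
    rw [← ih, Nat.cast_succ, ← add_assoc]
    refine mass_mul_Gamma_add_one ?_
    simp only [Complex.add_re, Complex.natCast_re]
    have : (0 : ℝ) ≤ n := by positivity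
    linarith

/-- The total mass of the circular Jacobi weight. -/
theorem mass_eq {δ : ℂ} (hδ : -(1 / 2 : ℝ) < δ.re) :
    mass δ * ‖Complex.Gamma (1 + δ)‖ ^ 2 = 2 * π * Real.Gamma (1 + 2 * δ.re) := by
  have hC : 0 < 1 + 2 * δ.re := by linarith
  have hG := Real.Gamma_pos_of_pos hC
  suffices h : mass δ * ‖Complex.Gamma (1 + δ)‖ ^ 2 / Real.Gamma (1 + 2 * δ.re) = 2 * π by
    rw [div_eq_iff hG.ne'] at h; exact h
  -- Far out, the invariant at `δ + n` is compared with the one at `n`, which equals `mass 0 = 2π`.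
  -- The Gamma asymptotics are taken along `2n` since `1 + 2 Re(δ + n) = 1 + 2 Re δ + 2n`; the
  -- resulting `2 ^ (2 Re δ)` cancels the limit of the mass ratio.
  have t1 := tendsto_mass_div hδ
  have t2 := (tendsto_norm_Gamma_add_nat (s := 1 + δ) (by simp; linarith)).pow 2
  have t3 := (tendsto_Gamma_add_nat hC).comp (tendsto_id.const_mul_atTop' (show 0 < 2 by norm_num))
  have t4 := ((t1.mul t2).div t3 one_ne_zero).const_mul ((2 : ℝ) * π * ((2 : ℝ) ^ (2 * δ.re))⁻¹)
  have e0 : mass 0 = 2 * π := by simp [mass, arcWeight]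
  have hlim : 2 * π * ((2 : ℝ) ^ (2 * δ.re))⁻¹ * (2 ^ (2 * δ.re) * 1 ^ 2 / 1) = 2 * π := by
    have : (2 : ℝ) ^ (2 * δ.re) ≠ 0 := (Real.rpow_pos_of_pos two_pos _).ne'
    field_simp
  rw [hlim] at t4
  refine tendsto_nhds_unique (tendsto_const_nhds.congr' ?_) t4
  filter_upwards [eventually_gt_atTop 0] with n hn
  have hn' : (0 : ℝ) < n := by exact_mod_cast hn
  have f1 := mass_mul_Gamma_add_nat hδ n
  have f2 := mass_mul_Gamma_add_nat (δ := 0) (by simp) n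
  simp only [zero_add, Complex.natCast_re, Complex.zero_re, mul_zero, add_zero, Complex.Gamma_one,
    norm_one, one_pow, mul_one, Real.Gamma_one, div_one, e0] at f2
  rw [add_comm (1 : ℂ), Complex.Gamma_nat_eq_factorial, add_comm (1 : ℝ)] at f2
  have g1 : Real.Gamma (2 * (n : ℝ) + 1) = ((2 * n)! : ℕ) := by
    rw [← Real.Gamma_nat_eq_factorial]; push_cast; rfl
  rw [g1, Complex.norm_natCast, div_eq_iff (by positivity)] at f2
  rw [← f1]
  simp only [Pi.div_apply, Function.comp_apply, id_eq, Complex.add_re, Complex.one_re, Complex.natCast_re]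
  have hm : mass (n : ℂ) ≠ 0 := (mass_pos (by rw [Complex.natCast_re]; linarith)).ne'
  have hG2 : Real.Gamma (1 + 2 * (δ.re + n)) ≠ 0 :=
    (Real.Gamma_pos_of_pos (by linarith)).ne'
  rw [show 1 + 2 * δ.re + ((2 * n : ℕ) : ℝ) = 1 + 2 * (δ.re + n) by push_cast; ring,
    show 1 + 2 * δ.re - 1 = 2 * δ.re by ring, show 1 + δ.re - 1 = δ.re by ring,
    show 1 + δ + (n : ℂ) = 1 + (δ + n) by ring, Nat.cast_mul, Nat.cast_ofNat,
    Real.mul_rpow two_pos.le hn'.le, show 2 * δ.re = δ.re + δ.re by ring, Real.rpow_add hn',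
    Real.rpow_add two_pos]
  have p1 := (Real.rpow_pos_of_pos hn' δ.re).ne'
  have p2 := (Real.rpow_pos_of_pos two_pos δ.re).ne'
  have p3 : (n ! : ℝ) ≠ 0 := by positivity
  have p4 : ((2 * n)! : ℝ) ≠ 0 := by positivity
  field_simp
  linear_combination (mass (δ + n) * ‖Complex.Gamma (1 + (δ + n))‖ ^ 2) * f2

/-! ### The hypergeometric polynomials -/

/-- The Pochhammer symbol. -/
abbrev poch (b : ℂ) (k : ℕ) : ℂ := (ascPochhammer ℂ k).eval b

@[simp] lemma poch_zero (b : ℂ) : poch b 0 = 1 := by simp [poch]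

lemma poch_succ (b : ℂ) (k : ℕ) : poch b (k + 1) = poch b k * (b + k) := by
  simp [poch, ascPochhammer_succ_eval]

lemma poch_succ_left (b : ℂ) (k : ℕ) : poch b (k + 1) = b * poch (b + 1) k := by
  simp [poch, ascPochhammer_succ_left, eval_comp]

lemma add_natCast_ne_zero {c : ℂ} (hc : 0 < c.re) (n : ℕ) : c + n ≠ 0 :=
  re_ne_zero_imp (by simp; positivity)

lemma poch_ne_zero {c : ℂ} (hc : 0 < c.re) (k : ℕ) : poch c k ≠ 0 := by
  induction k with
  | zero => simp
  | succ k ih => rw [poch_succ]; exact mul_ne_zero ih (add_natCast_ne_zero hc k)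

lemma conj_poch (b : ℂ) (k : ℕ) : conj (poch b k) = poch (conj b) k := by
  induction k with
  | zero => simp
  | succ k ih => rw [poch_succ, poch_succ, map_mul, ih]; simp

/-- The polynomial `₂F₁(-n, b; c; -X)`. -/
def hypPoly (b c : ℂ) (n : ℕ) : ℂ[X] :=
  ∑ k ∈ Finset.range (n + 1), monomial k ((n.choose k : ℂ) * (poch b k / poch c k))

lemma coeff_hypPoly (b c : ℂ) (n k : ℕ) :
    (hypPoly b c n).coeff k = (n.choose k : ℂ) * (poch b k / poch c k) := by
  rw [hypPoly, finsetSum_coeff]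
  simp only [coeff_monomial, Finset.sum_ite_eq', Finset.mem_range]
  split_ifs with h
  · rfl
  · rw [Nat.choose_eq_zero_of_lt (by omega)]; simp

lemma hypPoly_zero (b c : ℂ) : hypPoly b c 0 = 1 := by simp [hypPoly]

lemma natDegree_hypPoly_le (b c : ℂ) (n : ℕ) : (hypPoly b c n).natDegree ≤ n := by
  refine natDegree_le_iff_coeff_eq_zero.2 fun k hk => ?_
  rw [coeff_hypPoly, Nat.choose_eq_zero_of_lt hk]; simp

lemma choose_rec (n k : ℕ) :
    ((k : ℂ) + 1) * (n.choose (k + 1) : ℂ) = ((n : ℂ) - k) * (n.choose k : ℂ) := by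
  rcases le_or_gt k n with h | h
  · have := Nat.choose_succ_right_eq n k
    have h2 : ((n.choose (k + 1) * (k + 1) : ℕ) : ℂ) = ((n.choose k * (n - k) : ℕ) : ℂ) := by
      rw [this]
    push_cast [Nat.cast_sub h] at h2
    linear_combination h2
  · simp [Nat.choose_eq_zero_of_lt h, Nat.choose_eq_zero_of_lt (Nat.lt_succ_of_lt h)]

/-- With `hypPoly_succ'`, the pair of contiguous relations behind the Szegő recursion: a
coefficientwise check in which the factor `X + 1` is arranged to become `X` after `X ↦ X - 1`. -/
lemma hypPoly_succ (b e : ℂ) (hc : 0 < (b + e).re) (n : ℕ) :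
    C (b + e + n) * hypPoly b (b + e) (n + 1) =
      C (e + n) * hypPoly b (b + e) n + C b * ((X + 1) * hypPoly (b + 1) (b + e) n) := by
  ext k
  rw [add_mul, one_mul, mul_add]
  simp only [coeff_add, coeff_C_mul, coeff_hypPoly]
  rcases k with _ | k
  · simp; ring
  · have h1 := poch_ne_zero hc k
    have h2 := add_natCast_ne_zero hc k
    rw [coeff_X_mul, coeff_hypPoly, Nat.choose_succ_succ, poch_succ (b + e)]
    have e1 := poch_succ_left b k
    have e2 := poch_succ_left b (k + 1)
    rw [poch_succ b (k + 1), e1] at e2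
    rw [e1]
    push_cast at e2 ⊢
    have e3 := choose_rec n k
    field_simp
    linear_combination (n.choose (k + 1) : ℂ) * e2 - b * poch (b + 1) k * e3

lemma hypPoly_succ' (b c : ℂ) (hc : 0 < c.re) (n : ℕ) :
    C (c + n) * hypPoly (b + 1) c (n + 1) =
      C (b + 1 + n) * ((X + 1) * hypPoly (b + 1) c n) + C (c - (b + 1)) * hypPoly b c n := by
  ext k
  rw [add_mul, one_mul, mul_add]
  simp only [coeff_add, coeff_C_mul, coeff_hypPoly]
  rcases k with _ | k
  · simp; ring
  · have h1 := poch_ne_zero hc k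
    have h2 := add_natCast_ne_zero hc k
    rw [coeff_X_mul, coeff_hypPoly, Nat.choose_succ_succ, poch_succ c, poch_succ (b + 1),
      poch_succ_left b k]
    push_cast
    have e3 := choose_rec n k
    field_simp
    linear_combination poch (b + 1) k * (c - (b + 1)) * e3

lemma derivative_hypPoly (b c : ℂ) (n : ℕ) :
    derivative (hypPoly b c (n + 1)) = C ((n + 1) * (b / c)) * hypPoly (b + 1) (c + 1) n := by
  ext k
  rw [coeff_derivative, coeff_C_mul, coeff_hypPoly, coeff_hypPoly, poch_succ_left, poch_succ_left]
  have h : (((n + 1).choose (k + 1) * (k + 1) : ℕ) : ℂ) = (((n + 1) * n.choose k : ℕ) : ℂ) := by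
    rw [Nat.add_one_mul_choose_eq]
  push_cast at h
  rw [mul_div_mul_comm]
  linear_combination (b / c) * (poch (b + 1) k / poch (c + 1) k) * h

/-! ### Orthogonality -/

/-- The lower parameter `1 + δ + conj δ`. -/
def cPar (δ : ℂ) : ℂ := conj δ + (1 + δ)

lemma cPar_eq_ofReal (δ : ℂ) : cPar δ = ((1 + 2 * δ.re : ℝ) : ℂ) := by
  apply Complex.ext <;> simp [cPar]; ring

lemma cPar_re_pos {δ : ℂ} (hδ : -(1 / 2 : ℝ) < δ.re) : 0 < (cPar δ).re := by
  rw [cPar_eq_ofReal, Complex.ofReal_re]; linarith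

/-- A multiple of the reversed orthogonal polynomial, normalised by the value `1` at `1`. -/
def gPoly (δ : ℂ) (n : ℕ) : ℂ[X] := (hypPoly (conj δ) (cPar δ) n).comp (X - 1)

/-- A multiple of the orthogonal polynomial, normalised by the value `1` at `1`. -/
def fPoly (δ : ℂ) (n : ℕ) : ℂ[X] := (hypPoly (conj δ + 1) (cPar δ) n).comp (X - 1)

lemma gPoly_zero (δ : ℂ) : gPoly δ 0 = 1 := by simp [gPoly, hypPoly_zero]

lemma fPoly_zero (δ : ℂ) : fPoly δ 0 = 1 := by simp [fPoly, hypPoly_zero]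

/-- This and `fPoly_succ` are the Szegő recursion, normalised by the value `1` at `z = 1` rather
than by the leading coefficient. -/
lemma gPoly_succ {δ : ℂ} (hδ : -(1 / 2 : ℝ) < δ.re) (n : ℕ) :
    C (cPar δ + n) * gPoly δ (n + 1) =
      C (1 + δ + n) * gPoly δ n + C (conj δ) * (X * fPoly δ n) := by
  have := congrArg (fun p : ℂ[X] => p.comp (X - 1))
    (hypPoly_succ (conj δ) (1 + δ) (cPar_re_pos hδ) n)
  simp only [mul_comp, add_comp, C_comp, X_comp, one_comp, sub_add_cancel] at this
  exact this

lemma fPoly_succ {δ : ℂ} (hδ : -(1 / 2 : ℝ) < δ.re) (n : ℕ) :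
    C (cPar δ + n) * fPoly δ (n + 1) =
      C (conj δ + 1 + n) * (X * fPoly δ n) + C δ * gPoly δ n := by
  have := congrArg (fun p : ℂ[X] => p.comp (X - 1))
    (hypPoly_succ' (conj δ) (cPar δ) (cPar_re_pos hδ) n)
  simp only [mul_comp, add_comp, C_comp, X_comp, one_comp, sub_add_cancel] at this
  rw [show cPar δ - (conj δ + 1) = δ by rw [cPar]; ring] at this
  exact this

/-- The functional `p ↦ ∫ z⁻ʲ p(z) w`. -/
def pairing (δ : ℂ) (j : ℤ) (p : ℂ[X]) : ℂ :=
  ∫ θ in (0)..(2 * π), Complex.exp (-(Complex.I * (j * θ))) * p.eval (circPt θ) *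
    (arcWeight δ θ : ℂ)

lemma continuous_pairing_integrand (j : ℤ) (p : ℂ[X]) :
    Continuous fun θ : ℝ => Complex.exp (-(Complex.I * (j * θ))) * p.eval (circPt θ) :=
  Continuous.mul (by fun_prop) (p.continuous.comp continuous_circPt)

lemma pairing_add {δ : ℂ} (hδ : -(1 / 2 : ℝ) < δ.re) (j : ℤ) (p q : ℂ[X]) :
    pairing δ j (p + q) = pairing δ j p + pairing δ j q := by
  rw [pairing, pairing, pairing, ← intervalIntegral.integral_add
    (intervalIntegrable_mul_arcWeight hδ (continuous_pairing_integrand j p))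
    (intervalIntegrable_mul_arcWeight hδ (continuous_pairing_integrand j q))]
  congr 1; ext θ; rw [eval_add]; ring

lemma pairing_C_mul (δ : ℂ) (j : ℤ) (c : ℂ) (p : ℂ[X]) :
    pairing δ j (C c * p) = c * pairing δ j p := by
  rw [pairing, pairing, ← intervalIntegral.integral_const_mul]
  congr 1; ext θ; rw [eval_mul, eval_C]; ring

lemma pairing_X_mul (δ : ℂ) (j : ℤ) (p : ℂ[X]) :
    pairing δ j (X * p) = pairing δ (j - 1) p := by
  rw [pairing, pairing]
  congr 1; ext θ
  have : Complex.exp (-(Complex.I * (((j - 1 : ℤ) : ℂ) * θ))) =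
      Complex.exp (-(Complex.I * (j * θ))) * circPt θ := by
    rw [circPt, ← Complex.exp_add]; congr 1; push_cast; ring
  rw [eval_mul, eval_X, this]; ring

lemma pairing_one (δ : ℂ) (j : ℤ) : pairing δ j 1 = moment δ (-j) := by
  rw [pairing, moment]
  congr 1; ext θ; rw [eval_one, mul_one]; congr 2; push_cast; ring

/-- `(Γ(1 + conj δ - j + n) Γ(1 + δ + j))⁻¹`. -/
def gammaInv (δ : ℂ) (n : ℕ) (j : ℤ) : ℂ :=
  (Complex.Gamma (1 + conj δ - j + n))⁻¹ * (Complex.Gamma (1 + δ + j))⁻¹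

/-- The functional equation for `1/Γ` holds for every argument, poles included, so no integer `j`
has to be excluded. -/
lemma gammaInv_eq_succ (δ : ℂ) (n : ℕ) (j : ℤ) :
    gammaInv δ n j = (1 + conj δ - j + n) * gammaInv δ (n + 1) j := by
  rw [gammaInv, gammaInv, Complex.one_div_Gamma_eq_self_mul_one_div_Gamma_add_one
    (1 + conj δ - j + n), Nat.cast_succ, ← add_assoc]
  ring

lemma gammaInv_sub_one (δ : ℂ) (n : ℕ) (j : ℤ) :
    gammaInv δ n (j - 1) = (δ + j) * gammaInv δ (n + 1) j := by
  rw [gammaInv, gammaInv, Complex.one_div_Gamma_eq_self_mul_one_div_Gamma_add_one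
    (1 + δ + (j - 1 : ℤ))]
  push_cast
  rw [show 1 + δ + ((j : ℂ) - 1) + 1 = 1 + δ + j by ring,
    show 1 + conj δ - ((j : ℂ) - 1) + n = 1 + conj δ - j + (n + 1) by ring]
  ring

lemma mass_eq_gammaInv {δ : ℂ} (hδ : -(1 / 2 : ℝ) < δ.re) :
    (mass δ : ℂ) = ((2 * π * Real.Gamma (1 + 2 * δ.re) : ℝ) : ℂ) * gammaInv δ 0 0 := by
  have hG : Complex.Gamma (1 + δ) ≠ 0 := Complex.Gamma_ne_zero_of_re_pos (by simp; linarith)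
  have hG' : conj (Complex.Gamma (1 + δ)) ≠ 0 := by simpa using hG
  rw [← mass_eq hδ, gammaInv]
  push_cast
  rw [← Complex.mul_conj', show 1 + conj δ - 0 + 0 = conj (1 + δ) by simp, Complex.Gamma_conj,
    add_zero]
  field_simp

/-- Both sides satisfy the recursion of `moment_succ` and agree at `j = 0`. The induction runs in
both directions and divides only by `i + 1 + δ` or `i + 1 + conj δ`, which have positive real part.
-/
lemma moment_neg {δ : ℂ} (hδ : -(1 / 2 : ℝ) < δ.re) (j : ℤ) :
    moment δ (-j) = ((2 * π * Real.Gamma (1 + 2 * δ.re) : ℝ) : ℂ) * (-1) ^ j * gammaInv δ 0 j := by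
  induction j using Int.induction_on with
  | zero => rw [neg_zero, moment_zero, mass_eq_gammaInv hδ]; simp
  | succ i ih =>
    have h1 := moment_succ hδ (-((i : ℤ) + 1))
    rw [neg_add, neg_add_cancel_right, ih] at h1
    have hne : (i : ℂ) + 1 + δ ≠ 0 := re_ne_zero_imp (by simp; linarith)
    have e1 := gammaInv_sub_one δ 0 (i + 1)
    have e2 := gammaInv_eq_succ δ 0 (i + 1)
    rw [add_sub_cancel_right] at e1
    rw [e1] at h1
    rw [neg_add, e2, zpow_add_one₀ (by norm_num)]
    push_cast at h1 ⊢
    apply mul_left_cancel₀ hne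
    linear_combination h1
  | pred i ih =>
    have h1 := moment_succ hδ (i : ℤ)
    rw [show -(-(i : ℤ)) = i by ring] at ih
    rw [ih] at h1
    have hne : (i : ℂ) + 1 + conj δ ≠ 0 := re_ne_zero_imp (by simp; linarith)
    have e1 := gammaInv_sub_one δ 0 (-(i : ℤ))
    have e2 := gammaInv_eq_succ δ 0 (-(i : ℤ))
    rw [show -(-(i : ℤ) - 1) = i + 1 by ring, e1, zpow_sub_one₀ (by norm_num)]
    rw [e2] at h1
    push_cast at h1 ⊢
    apply mul_left_cancel₀ hne
    linear_combination h1

/-- The Szegő recursion carries both formulas along simultaneously; multiplication by `X` shifts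
`j`, so `j` must stay universally quantified. The products vanish for `1 ≤ j ≤ n` (for `g`) and `0 ≤
j < n` (for `f`): this is the orthogonality. -/
lemma pairing_poly {δ : ℂ} (hδ : -(1 / 2 : ℝ) < δ.re) (n : ℕ) : ∀ j : ℤ,
    pairing δ j (gPoly δ n) = ((2 * π * Real.Gamma (1 + 2 * δ.re) : ℝ) : ℂ) * (-1) ^ j *
        (∏ i ∈ Finset.range n, ((i : ℂ) + 1 - j)) * gammaInv δ n j ∧
    pairing δ j (fPoly δ n) = ((2 * π * Real.Gamma (1 + 2 * δ.re) : ℝ) : ℂ) * (-1) ^ j *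
        (∏ i ∈ Finset.range n, ((i : ℂ) - j)) * gammaInv δ n j := by
  induction n with
  | zero => intro j; simp [gPoly_zero, fPoly_zero, pairing_one, moment_neg hδ]
  | succ n ih =>
    intro j
    have hne : cPar δ + n ≠ 0 := add_natCast_ne_zero (cPar_re_pos hδ) n
    have hg := congrArg (pairing δ j) (gPoly_succ hδ n)
    have hf := congrArg (pairing δ j) (fPoly_succ hδ n)
    rw [pairing_add hδ] at hg hf
    simp only [pairing_C_mul, pairing_X_mul] at hg hf
    have e : ∏ i ∈ Finset.range n, ((i : ℂ) - (j - 1 : ℤ)) =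
        ∏ i ∈ Finset.range n, ((i : ℂ) + 1 - j) :=
      Finset.prod_congr rfl fun i _ => by push_cast; ring
    rw [(ih j).1, (ih (j - 1)).2, e, gammaInv_sub_one,
      gammaInv_eq_succ δ n j,
      zpow_sub_one₀ (by norm_num)] at hg hf
    constructor
    · rw [Finset.prod_range_succ]
      apply mul_left_cancel₀ hne
      rw [hg, cPar]
      push_cast
      ring
    · rw [Finset.prod_range_succ']
      apply mul_left_cancel₀ hne
      rw [hf, cPar]
      push_cast
      ring

/-- On the circle `conj (z ^ k) = z ^ (-k)`, so expanding the first argument reduces scalar products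
to pairings. -/
lemma circInner_eq_sum {δ : ℂ} (hδ : -(1 / 2 : ℝ) < δ.re) (p q : ℂ[X]) {N : ℕ}
    (hp : p.natDegree < N) :
    circInner (weight δ) p q = ∑ k ∈ Finset.range N, conj (p.coeff k) * pairing δ k q := by
  rw [circInner, integral_weight_mul (fun θ => by rw [circPt_add_two_pi])]
  simp only [pairing]
  simp_rw [← intervalIntegral.integral_const_mul]
  rw [← intervalIntegral.integral_finsetSum fun (k : ℕ) _ => (intervalIntegrable_mul_arcWeight hδ
    (continuous_pairing_integrand (k : ℤ) q)).const_mul (conj (p.coeff k))]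
  congr 1; ext θ
  rw [eval_eq_sum_range' hp, map_sum, Finset.sum_mul, Finset.sum_mul]
  refine Finset.sum_congr rfl fun k _ => ?_
  have : Complex.exp (-(Complex.I * (((k : ℤ) : ℂ) * θ))) = conj (circPt θ ^ k) := by
    rw [circPt, ← Complex.exp_nat_mul, ← Complex.exp_conj]; congr 1; simp; ring
  rw [this, map_mul]; ring

lemma circInner_conj (w : ℂ → ℝ) (p q : ℂ[X]) : conj (circInner w p q) = circInner w q p := by
  rw [circInner, circInner, intervalIntegral, intervalIntegral, map_sub, ← integral_conj,
    ← integral_conj]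
  simp only [map_mul, Complex.conj_conj, Complex.conj_ofReal]
  congr 2 <;> (ext θ; ring)

/-- The squared norm of `fPoly δ n`. -/
def hNorm (δ : ℂ) (n : ℕ) : ℝ :=
  mass δ * ∏ l ∈ Finset.range n, (((l : ℝ) + 1) / (1 + 2 * δ.re + l))

lemma hNorm_pos {δ : ℂ} (hδ : -(1 / 2 : ℝ) < δ.re) (n : ℕ) : 0 < hNorm δ n :=
  mul_pos (mass_pos hδ) (Finset.prod_pos fun l _ =>
    div_pos (by positivity) (by have : (0 : ℝ) ≤ l := l.cast_nonneg; linarith))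

lemma hNorm_succ {δ : ℂ} (hδ : -(1 / 2 : ℝ) < δ.re) (n : ℕ) :
    (1 + 2 * δ.re + n) * hNorm δ (n + 1) = (n + 1) * hNorm δ n := by
  have : (0 : ℝ) < 1 + 2 * δ.re + n := by have : (0 : ℝ) ≤ n := n.cast_nonneg; linarith
  rw [hNorm, Finset.prod_range_succ, hNorm]
  field_simp

lemma hNorm_succ' {δ : ℂ} (hδ : -(1 / 2 : ℝ) < δ.re) (n : ℕ) :
    (cPar δ + n) * (hNorm δ (n + 1) : ℂ) = (n + 1) * (hNorm δ n : ℂ) := by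
  rw [cPar_eq_ofReal]; exact_mod_cast hNorm_succ hδ n

lemma poch_mul_hNorm {δ : ℂ} (hδ : -(1 / 2 : ℝ) < δ.re) (n : ℕ) :
    poch (cPar δ) n * (hNorm δ n : ℂ) = mass δ * (n ! : ℂ) := by
  induction n with
  | zero => simp [hNorm]
  | succ n ih =>
    rw [poch_succ, mul_assoc, hNorm_succ' hδ, Nat.factorial_succ]
    push_cast
    linear_combination ((n : ℂ) + 1) * ih

/-- The leading coefficient of `fPoly δ n`. -/
def fLead (δ : ℂ) (n : ℕ) : ℂ := poch (conj δ + 1) n / poch (cPar δ) n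

lemma fLead_ne_zero {δ : ℂ} (hδ : -(1 / 2 : ℝ) < δ.re) (n : ℕ) : fLead δ n ≠ 0 :=
  div_ne_zero (poch_ne_zero (by simp; linarith) n) (poch_ne_zero (cPar_re_pos hδ) n)

lemma natDegree_fPoly {δ : ℂ} (hδ : -(1 / 2 : ℝ) < δ.re) (n : ℕ) : (fPoly δ n).natDegree = n := by
  rw [fPoly, natDegree_comp, ← C_1, natDegree_X_sub_C, mul_one]
  refine natDegree_eq_of_le_of_coeff_ne_zero (natDegree_hypPoly_le _ _ _) ?_
  rw [coeff_hypPoly, Nat.choose_self, Nat.cast_one, one_mul]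
  exact fLead_ne_zero hδ n

lemma coeff_fPoly_self {δ : ℂ} (hδ : -(1 / 2 : ℝ) < δ.re) (n : ℕ) :
    (fPoly δ n).coeff n = fLead δ n := by
  have h := natDegree_fPoly hδ n
  have h' : (hypPoly (conj δ + 1) (cPar δ) n).natDegree = n := by
    rw [fPoly, natDegree_comp, ← C_1, natDegree_X_sub_C, mul_one] at h; exact h
  have h2 : (fPoly δ n).coeff n = (fPoly δ n).leadingCoeff := by rw [leadingCoeff, h]
  rw [h2, fPoly, leadingCoeff_comp (by rw [← C_1, natDegree_X_sub_C]; exact one_ne_zero),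
    ← C_1, leadingCoeff_X_sub_C, one_pow, mul_one, leadingCoeff, h', coeff_hypPoly, Nat.choose_self,
    Nat.cast_one, one_mul]
  rfl

lemma prod_range_sub_self (n : ℕ) : ∏ i ∈ Finset.range n, ((n : ℂ) - i) = n ! := by
  induction n with
  | zero => simp
  | succ n ih =>
    rw [Finset.prod_range_succ', Nat.factorial_succ, Nat.cast_mul, ← ih]
    push_cast
    rw [sub_zero, mul_comm]
    congr 1
    exact Finset.prod_congr rfl fun i _ => by ring

lemma poch_mul_Gamma_inv (b : ℂ) (n : ℕ) :
    poch b n * (Complex.Gamma (b + n))⁻¹ = (Complex.Gamma b)⁻¹ := by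
  induction n with
  | zero => simp
  | succ n ih =>
    rw [← ih, Complex.one_div_Gamma_eq_self_mul_one_div_Gamma_add_one (b + n), poch_succ,
      Nat.cast_succ, ← add_assoc, mul_assoc]

/-- Expanding the polynomial of lower degree leaves only pairings of index below `n`, all zero,
except that for `l = n` the leading coefficient meets the pairing of index `n`. -/
lemma circInner_fPoly_of_le {δ : ℂ} (hδ : -(1 / 2 : ℝ) < δ.re) {l n : ℕ} (h : l ≤ n) :
    circInner (weight δ) (fPoly δ l) (fPoly δ n) = if l = n then (hNorm δ n : ℂ) else 0 := by
  rw [circInner_eq_sum hδ _ _ (Nat.lt_succ_of_le (natDegree_fPoly hδ l).le), Finset.sum_range_succ]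
  have hz : ∀ k < n, pairing δ k (fPoly δ n) = 0 := fun k hk => by
    rw [(pairing_poly hδ n k).2, Finset.prod_eq_zero (Finset.mem_range.2 hk) (by simp)]; simp
  rw [Finset.sum_eq_zero fun k hk => by
    rw [hz k (lt_of_lt_of_le (Finset.mem_range.1 hk) h), mul_zero], zero_add]
  split_ifs with hln
  · subst hln
    rw [coeff_fPoly_self hδ, (pairing_poly hδ l l).2, gammaInv, fLead, map_div₀, conj_poch, conj_poch]
    have e1 : conj (cPar δ) = cPar δ := by rw [cPar_eq_ofReal, Complex.conj_ofReal]
    have e2 : ∏ i ∈ Finset.range l, ((i : ℂ) - ((l : ℤ) : ℂ)) = (-1) ^ l * (l ! : ℂ) := by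
      rw [← prod_range_sub_self, ← Finset.card_range l, ← Finset.prod_const, Finset.card_range,
        ← Finset.prod_mul_distrib]
      exact Finset.prod_congr rfl fun i _ => by push_cast; ring
    have e3 := poch_mul_Gamma_inv (1 + δ) l
    have e4 := mass_eq_gammaInv hδ
    have e5 := poch_mul_hNorm hδ l
    have e6 : ((-1 : ℂ) ^ l) * (-1) ^ l = 1 := by rw [← mul_pow]; simp
    have hp := poch_ne_zero (cPar_re_pos hδ) l
    rw [gammaInv] at e4
    simp only [Int.cast_zero, sub_zero, Nat.cast_zero, add_zero] at e4
    rw [e1, e2, map_add, Complex.conj_conj, map_one, add_comm δ 1, zpow_natCast, Int.cast_natCast,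
      sub_add_cancel, div_mul_eq_mul_div, div_eq_iff hp, mul_comm (hNorm δ l : ℂ), e5, e4, ← e3]
    linear_combination (poch (1 + δ) l * ((2 * π * Real.Gamma (1 + 2 * δ.re) : ℝ) : ℂ) * (l ! : ℂ) *
      (Complex.Gamma (1 + conj δ))⁻¹ * (Complex.Gamma (1 + δ + l))⁻¹) * e6
  · rw [hz l (lt_of_le_of_ne h hln), mul_zero]

/-- The polynomials `fPoly δ n` are orthogonal with respect to the circular Jacobi weight. -/
theorem circInner_fPoly {δ : ℂ} (hδ : -(1 / 2 : ℝ) < δ.re) (l n : ℕ) :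
    circInner (weight δ) (fPoly δ l) (fPoly δ n) = if l = n then (hNorm δ n : ℂ) else 0 := by
  rcases le_total l n with h | h
  · exact circInner_fPoly_of_le hδ h
  · rw [← circInner_conj, circInner_fPoly_of_le hδ h]
    by_cases hln : n = l
    · subst hln; simp
    · simp [hln, Ne.symm hln]

/-! ### The Christoffel–Darboux formula -/

/-- The reproducing kernel `∑ l < n, conj (f_l z) f_l ζ / ‖f_l‖ ^ 2`. -/
def cdKernel (δ : ℂ) (n : ℕ) (z ζ : ℂ) : ℂ :=
  ∑ l ∈ Finset.range n, conj ((fPoly δ l).eval z) * (fPoly δ l).eval ζ / (hNorm δ l : ℂ)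

lemma eval_gPoly_succ {δ : ℂ} (hδ : -(1 / 2 : ℝ) < δ.re) (n : ℕ) (z : ℂ) :
    (cPar δ + n) * (gPoly δ (n + 1)).eval z =
      (1 + δ + n) * (gPoly δ n).eval z + conj δ * (z * (fPoly δ n).eval z) := by
  simpa only [eval_mul, eval_add, eval_C, eval_X] using congrArg (eval z) (gPoly_succ hδ n)

lemma eval_fPoly_succ {δ : ℂ} (hδ : -(1 / 2 : ℝ) < δ.re) (n : ℕ) (z : ℂ) :
    (cPar δ + n) * (fPoly δ (n + 1)).eval z =
      (conj δ + 1 + n) * (z * (fPoly δ n).eval z) + δ * (gPoly δ n).eval z := by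
  simpa only [eval_mul, eval_add, eval_C, eval_X] using congrArg (eval z) (fPoly_succ hδ n)

/-- The Christoffel–Darboux formula. -/
theorem christoffelDarboux {δ : ℂ} (hδ : -(1 / 2 : ℝ) < δ.re) (n : ℕ) (z ζ : ℂ) :
    conj ((gPoly δ n).eval z) * (gPoly δ n).eval ζ -
        conj ((fPoly δ n).eval z) * (fPoly δ n).eval ζ =
      hNorm δ n * (1 - conj z * ζ) * cdKernel δ n z ζ := by
  induction n with
  | zero => simp [gPoly_zero, fPoly_zero, cdKernel]
  | succ n ih =>
    have hne : cPar δ + n ≠ 0 := add_natCast_ne_zero (cPar_re_pos hδ) n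
    have hh : (hNorm δ n : ℂ) ≠ 0 := by exact_mod_cast (hNorm_pos hδ n).ne'
    have g1 := eval_gPoly_succ hδ n ζ
    have f1 := eval_fPoly_succ hδ n ζ
    have g2 := congrArg conj (eval_gPoly_succ hδ n z)
    have f2 := congrArg conj (eval_fPoly_succ hδ n z)
    simp only [map_add, map_mul, Complex.conj_conj, map_one, map_natCast] at g2 f2
    have hc : conj (cPar δ) = cPar δ := by rw [cPar_eq_ofReal, Complex.conj_ofReal]
    rw [hc] at g2 f2
    have h1 := hNorm_succ' hδ n
    have hS : hNorm δ n * cdKernel δ (n + 1) z ζ = hNorm δ n * cdKernel δ n z ζ +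
        conj ((fPoly δ n).eval z) * (fPoly δ n).eval ζ := by
      rw [cdKernel, Finset.sum_range_succ, ← cdKernel]; field_simp
    apply mul_left_cancel₀ (mul_ne_zero hne hne)
    have lhs1 : (cPar δ + n) * (cPar δ + n) * (conj ((gPoly δ (n + 1)).eval z) *
        (gPoly δ (n + 1)).eval ζ - conj ((fPoly δ (n + 1)).eval z) * (fPoly δ (n + 1)).eval ζ) =
        ((cPar δ + n) * conj ((gPoly δ (n + 1)).eval z)) *
          ((cPar δ + n) * (gPoly δ (n + 1)).eval ζ) -
        ((cPar δ + n) * conj ((fPoly δ (n + 1)).eval z)) *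
          ((cPar δ + n) * (fPoly δ (n + 1)).eval ζ) := by ring
    rw [lhs1, g1, g2, f1, f2]
    have hcp : cPar δ = conj δ + (1 + δ) := rfl
    -- With `α = 1 + δ + n` and `β = conj δ` the recursion is `(α g + β z f, conj α z f + conj β
    -- g)`. The cross terms of the form cancel and the rest is scaled by `|α|² - |β|² = (n + 1)(cPar
    -- δ + n)`, which matches the ratio of consecutive norms.
    linear_combination (-(cPar δ + n) * (1 - conj z * ζ) * cdKernel δ (n + 1) z ζ) * h1 -
      (cPar δ + n) * (n + 1) * (1 - conj z * ζ) * hS + (cPar δ + n) * (n + 1) * ih -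
      (n + 1) * (conj ((gPoly δ n).eval z) * (gPoly δ n).eval ζ -
        conj z * ζ * (conj ((fPoly δ n).eval z) * (fPoly δ n).eval ζ)) * hcp

/-- On the circle the reversal `p ↦ z ^ n conj p` exchanges the two Szegő recursions. -/
lemma fPoly_eq_reverse {δ : ℂ} (hδ : -(1 / 2 : ℝ) < δ.re) (n : ℕ) {z : ℂ} (hz : conj z * z = 1) :
    (fPoly δ n).eval z = z ^ n * conj ((gPoly δ n).eval z) := by
  induction n with
  | zero => simp [gPoly_zero, fPoly_zero]
  | succ n ih =>
    have hne : cPar δ + n ≠ 0 := add_natCast_ne_zero (cPar_re_pos hδ) n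
    have f1 := eval_fPoly_succ hδ n z
    have g2 := congrArg conj (eval_gPoly_succ hδ n z)
    have hc : conj (cPar δ) = cPar δ := by rw [cPar_eq_ofReal, Complex.conj_ofReal]
    simp only [map_add, map_mul, Complex.conj_conj, map_one, map_natCast, hc] at g2
    have ih' := congrArg conj ih
    simp only [map_mul, map_pow, Complex.conj_conj] at ih'
    have hzn : conj z ^ n * z ^ n = 1 := by rw [← mul_pow, hz, one_pow]
    apply mul_left_cancel₀ hne
    rw [f1, mul_left_comm (cPar δ + n), g2, ih', ih, pow_succ]
    linear_combination -(δ * (gPoly δ n).eval z * z ^ n * conj z ^ n) * hz -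
      δ * (gPoly δ n).eval z * hzn

/-! ### Identification of the orthonormal polynomials -/

lemma exists_sum_of_coeff_eq_zero {Φ : ℕ → ℂ[X]} (hm : ∀ n, (Φ n).coeff n = 1)
    (hd : ∀ n, (Φ n).natDegree ≤ n) (n : ℕ) : ∀ p : ℂ[X], (∀ k, n ≤ k → p.coeff k = 0) →
      ∃ c : ℕ → ℂ, p = ∑ l ∈ Finset.range n, C (c l) * Φ l := by
  induction n with
  | zero => exact fun p hp => ⟨0, by ext k; simp [hp k]⟩
  | succ n ih =>
    intro p hp
    obtain ⟨c, hc⟩ := ih (p - C (p.coeff n) * Φ n) fun k hk => by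
      rw [coeff_sub, coeff_C_mul]
      rcases eq_or_lt_of_le hk with h | h
      · rw [← h, hm, mul_one, sub_self]
      · rw [hp k h, coeff_eq_zero_of_natDegree_lt (lt_of_le_of_lt (hd n) h), mul_zero, sub_zero]
    refine ⟨fun l => if l = n then p.coeff n else c l, ?_⟩
    rw [Finset.sum_range_succ]
    simp only [↓reduceIte]
    rw [← sub_eq_iff_eq_add, hc]
    exact Finset.sum_congr rfl fun l hl => by rw [if_neg (Finset.mem_range.1 hl).ne]

lemma circInner_C_mul_right (w : ℂ → ℝ) (p q : ℂ[X]) (c : ℂ) :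
    circInner w p (C c * q) = c * circInner w p q := by
  rw [circInner, circInner, ← intervalIntegral.integral_const_mul]
  congr 1; ext θ; rw [eval_mul, eval_C]; ring

lemma circInner_C_mul_left (w : ℂ → ℝ) (p q : ℂ[X]) (c : ℂ) :
    circInner w (C c * p) q = conj c * circInner w p q := by
  rw [← circInner_conj, circInner_C_mul_right, map_mul, circInner_conj]

/-- The difference `X ^ n - Φ n` is a combination of the lower `Φ l`, and orthogonality forces its
coefficients to be those of Gram–Schmidt. Additivity is assumed because an integral is additive only
on integrable functions. -/
lemma monicOP_unique {w : ℂ → ℝ}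
    (hadd : ∀ p q r, circInner w p (q + r) = circInner w p q + circInner w p r)
    {Φ : ℕ → ℂ[X]} (hm : ∀ n, (Φ n).coeff n = 1) (hd : ∀ n, (Φ n).natDegree ≤ n)
    (ho : ∀ l n, l ≠ n → circInner w (Φ l) (Φ n) = 0) (hn : ∀ n, circInner w (Φ n) (Φ n) ≠ 0)
    (n : ℕ) : monicOP w n = Φ n := by
  induction n using Nat.strong_induction_on with
  | _ n ih =>
    obtain ⟨c, hc⟩ := exists_sum_of_coeff_eq_zero hm hd n (X ^ n - Φ n) fun k hk => by
      rw [coeff_sub, coeff_X_pow]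
      rcases eq_or_lt_of_le hk with h | h
      · simp [← h, hm]
      · rw [if_neg h.ne', coeff_eq_zero_of_natDegree_lt (lt_of_le_of_lt (hd n) h), sub_zero]
    have hX : X ^ n = Φ n + ∑ l ∈ Finset.range n, C (c l) * Φ l := by rw [← hc]; ring
    have hsum : ∀ (p : ℂ[X]) (s : Finset ℕ), circInner w p (∑ l ∈ s, C (c l) * Φ l) =
        ∑ l ∈ s, c l * circInner w p (Φ l) := by
      intro p s
      induction s using Finset.induction_on with
      | empty => simp [circInner]
      | insert a s ha hs =>
        rw [Finset.sum_insert ha, Finset.sum_insert ha, hadd, hs, circInner_C_mul_right]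
    rw [monicOP]
    have hco : ∀ l : Fin n, C (circInner w (monicOP w l) (X ^ n) /
        circInner w (monicOP w l) (monicOP w l)) * monicOP w l = C (c l) * Φ l := by
      intro l
      rw [ih l l.2, hX, hadd, ho _ _ l.2.ne, zero_add, hsum,
        Finset.sum_eq_single_of_mem (l : ℕ) (Finset.mem_range.2 l.2) fun k _ hk => by
          rw [ho _ _ hk.symm, mul_zero], mul_div_cancel_right₀ _ (hn l)]
    rw [Finset.sum_congr rfl fun l _ => hco l, Fin.sum_univ_eq_sum_range fun l => C (c l) * Φ l, hX,
      add_sub_cancel_right]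

lemma circInner_nweight (δ : ℂ) (p q : ℂ[X]) :
    circInner (nweight δ) p q = normConst δ * circInner (weight δ) p q := by
  rw [circInner, circInner, ← intervalIntegral.integral_const_mul]
  congr 1; ext θ; rw [nweight]; push_cast; ring

lemma circInner_weight_add {δ : ℂ} (hδ : -(1 / 2 : ℝ) < δ.re) (p q r : ℂ[X]) :
    circInner (weight δ) p (q + r) = circInner (weight δ) p q + circInner (weight δ) p r := by
  simp only [circInner_eq_sum hδ p _ (Nat.lt_succ_self _), pairing_add hδ, mul_add,
    Finset.sum_add_distrib]

lemma normConst_pos {δ : ℂ} (hδ : -(1 / 2 : ℝ) < δ.re) : 0 < normConst δ := by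
  have hG : Complex.Gamma (1 + δ) ≠ 0 := Complex.Gamma_ne_zero_of_re_pos (by simp; linarith)
  have h2 := Real.Gamma_pos_of_pos (show 0 < 1 + 2 * δ.re by linarith)
  rw [normConst]
  positivity

lemma monicOP_nweight {δ : ℂ} (hδ : -(1 / 2 : ℝ) < δ.re) (n : ℕ) :
    monicOP (nweight δ) n = C (fLead δ n)⁻¹ * fPoly δ n := by
  have hc : (normConst δ : ℂ) ≠ 0 := by exact_mod_cast (normConst_pos hδ).ne'
  refine monicOP_unique (Φ := fun n => C (fLead δ n)⁻¹ * fPoly δ n) (fun p q r => ?_) (fun n => ?_)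
    (fun n => ?_) (fun l n hln => ?_) (fun n => ?_) n
  · simp only [circInner_nweight, circInner_weight_add hδ, mul_add]
  · rw [coeff_C_mul, coeff_fPoly_self hδ, inv_mul_cancel₀ (fLead_ne_zero hδ n)]
  · exact (natDegree_C_mul_le _ _).trans (natDegree_fPoly hδ n).le
  · rw [circInner_C_mul_left, circInner_C_mul_right, circInner_nweight, circInner_fPoly hδ,
      if_neg hln]; simp
  · rw [circInner_C_mul_left, circInner_C_mul_right, circInner_nweight, circInner_fPoly hδ,
      if_pos rfl]
    have := fLead_ne_zero hδ n
    have h2 : (hNorm δ n : ℂ) ≠ 0 := by exact_mod_cast (hNorm_pos hδ n).ne'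
    simp [this, h2, hc]

/-- The leading coefficient of `fPoly` is complex, so the normalised `f_l` agrees with `φ_l` only up
to a unimodular constant; that constant cancels in the products forming the kernel. -/
lemma orthonormalOP_mul {δ : ℂ} (hδ : -(1 / 2 : ℝ) < δ.re) (l : ℕ) (z ζ : ℂ) :
    conj ((orthonormalOP (nweight δ) l).eval z) * (orthonormalOP (nweight δ) l).eval ζ =
      conj ((fPoly δ l).eval z) * (fPoly δ l).eval ζ / (normConst δ * hNorm δ l) := by
  have hc := normConst_pos hδ
  have hh := hNorm_pos hδ l
  have hf := fLead_ne_zero hδ l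
  have hf' : conj (fLead δ l) ≠ 0 := by simpa using hf
  have e : (circInner (nweight δ) (monicOP (nweight δ) l) (monicOP (nweight δ) l)).re =
      normConst δ * hNorm δ l / ‖fLead δ l‖ ^ 2 := by
    rw [monicOP_nweight hδ, circInner_C_mul_left, circInner_C_mul_right, circInner_nweight,
      circInner_fPoly hδ, if_pos rfl, ← Complex.ofReal_re (normConst δ * hNorm δ l / _)]
    congr 1
    push_cast
    rw [← Complex.conj_mul', map_inv₀]
    field_simp
  have hr : (0 : ℝ) ≤ normConst δ * hNorm δ l / ‖fLead δ l‖ ^ 2 := by positivity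
  have hs := Real.mul_self_sqrt hr
  have hs' : ((√(normConst δ * hNorm δ l / ‖fLead δ l‖ ^ 2) : ℝ) : ℂ) *
      (√(normConst δ * hNorm δ l / ‖fLead δ l‖ ^ 2) : ℝ) =
      normConst δ * hNorm δ l / (conj (fLead δ l) * fLead δ l) := by
    rw [← Complex.ofReal_mul, hs, Complex.conj_mul']; push_cast; rfl
  rw [orthonormalOP, e, monicOP_nweight hδ]
  simp only [eval_mul, eval_C, map_mul, Complex.conj_ofReal, map_inv₀]
  generalize √(normConst δ * hNorm δ l / ‖fLead δ l‖ ^ 2) = s at *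
  have hcc : (normConst δ : ℂ) ≠ 0 := by exact_mod_cast hc.ne'
  have hhc : (hNorm δ l : ℂ) ≠ 0 := by exact_mod_cast hh.ne'
  have hsne : (s : ℂ) ≠ 0 := by
    intro h0
    rw [h0, zero_mul, eq_comm] at hs'
    exact (div_ne_zero (mul_ne_zero hcc hhc) (mul_ne_zero hf' hf)) hs'
  rw [eq_div_iff (mul_ne_zero hf' hf)] at hs'
  push_cast
  field_simp
  linear_combination -(conj ((fPoly δ l).eval z) * (fPoly δ l).eval ζ) * hs'

/-- The kernel for the normalised weight in terms of the Christoffel–Darboux kernel. -/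
theorem kernel_nweight {δ : ℂ} (hδ : -(1 / 2 : ℝ) < δ.re) (n : ℕ) (z ζ : ℂ) :
    kernel (nweight δ) n z ζ = (√(weight δ z * weight δ ζ) : ℂ) * cdKernel δ n z ζ := by
  have hc := normConst_pos hδ
  have hcc : (normConst δ : ℂ) ≠ 0 := by exact_mod_cast hc.ne'
  have e : √(nweight δ z * nweight δ ζ) = normConst δ * √(weight δ z * weight δ ζ) := by
    rw [nweight, nweight, show normConst δ * weight δ z * (normConst δ * weight δ ζ) =
      normConst δ ^ 2 * (weight δ z * weight δ ζ) by ring, Real.sqrt_mul (sq_nonneg _),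
      Real.sqrt_sq hc.le]
  rw [kernel, e, cdKernel, Complex.ofReal_mul, mul_comm (normConst δ : ℂ), mul_assoc, Finset.mul_sum]
  congr 1
  refine Finset.sum_congr rfl fun l _ => ?_
  have hhc : (hNorm δ l : ℂ) ≠ 0 := by exact_mod_cast (hNorm_pos hδ l).ne'
  rw [orthonormalOP_mul hδ]
  field_simp

/-! ### Asymptotics of the hypergeometric polynomials and of the weight -/

lemma tendsto_choose_div_pow (k : ℕ) :
    Tendsto (fun n : ℕ => (n.choose k : ℂ) / (n : ℂ) ^ k) atTop (𝓝 (1 / (k ! : ℂ))) := by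
  induction k with
  | zero => simp
  | succ k ih =>
    have h1 : Tendsto (fun n : ℕ => ((n : ℂ) - k) / n) atTop (𝓝 1) := by
      have h2 : Tendsto (fun n : ℕ => 1 - (k : ℂ) / n) atTop (𝓝 (1 - 0)) :=
        tendsto_const_nhds.sub (tendsto_const_div_atTop_nhds_zero_nat (k : ℂ))
      rw [sub_zero] at h2
      refine h2.congr' ?_
      filter_upwards [eventually_gt_atTop 0] with n hn
      have : (n : ℂ) ≠ 0 := by exact_mod_cast hn.ne'
      field_simp
    have h3 := (ih.mul h1).div_const ((k : ℂ) + 1)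
    have hk : (k : ℂ) + 1 ≠ 0 := by exact_mod_cast k.succ_ne_zero
    have e : 1 / (k ! : ℂ) * 1 / ((k : ℂ) + 1) = 1 / ((k + 1)! : ℂ) := by
      rw [Nat.factorial_succ]; push_cast
      have : (k ! : ℂ) ≠ 0 := by exact_mod_cast k.factorial_ne_zero
      field_simp
    rw [e] at h3
    refine h3.congr' ?_
    filter_upwards [eventually_gt_atTop 0] with n hn
    have : (n : ℂ) ≠ 0 := by exact_mod_cast hn.ne'
    have h4 := choose_rec n k
    rw [div_mul_div_comm, div_div, pow_succ,
      div_eq_div_iff (by positivity) (by positivity)]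
    linear_combination -((n : ℂ) ^ k * n) * h4

/-- Each factor satisfies `|b + k| / |c + k| ≤ (|b| + k) / (Re c + k)`. The geometric bound is
crude, but the `k!` in the denominator absorbs it. -/
lemma norm_poch_div_le (b : ℂ) {c : ℂ} (hc : 0 < c.re) (k : ℕ) :
    ‖poch b k / poch c k‖ ≤ (1 + ‖b‖ / c.re) ^ k := by
  induction k with
  | zero => simp
  | succ k ih =>
    have hR : 0 ≤ ‖b‖ / c.re := by positivity
    have h1 : ‖(b + k) / (c + k)‖ ≤ 1 + ‖b‖ / c.re := by
      have h2 : c.re + k ≤ ‖c + k‖ := by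
        have := Complex.re_le_norm (c + k); simpa using this
      have h3 : ‖b + k‖ ≤ ‖b‖ + k := by
        have := norm_add_le b (k : ℂ); simpa using this
      have h4 : 0 < c.re + k := by positivity
      rw [norm_div, div_le_iff₀ (h4.trans_le h2)]
      calc ‖b + k‖ ≤ ‖b‖ + k := h3
        _ ≤ (1 + ‖b‖ / c.re) * (c.re + k) := by
          have : ‖b‖ / c.re * c.re = ‖b‖ := div_mul_cancel₀ _ hc.ne'
          have h5 : 0 ≤ ‖b‖ / c.re * (k : ℝ) := by positivity
          nlinarith
        _ ≤ _ := by gcongr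
    rw [poch_succ, poch_succ, mul_div_mul_comm, norm_mul, pow_succ]
    gcongr

/-- The confluence of `₂F₁(-n, b; c; -x/n)` to `₁F₁(b; c; x)`. Termwise, `n.choose k / n ^ k → 1 /
k!`; domination uses `n.choose k ≤ n ^ k / k!` and the eventual bound `|n v_n| ≤ |x| + 1`. -/
lemma tendsto_hypPoly (b : ℂ) {c : ℂ} (hc : 0 < c.re) {v : ℕ → ℂ} {x : ℂ}
    (hv : Tendsto (fun n : ℕ => (n : ℂ) * v n) atTop (𝓝 x)) :
    Tendsto (fun n => (hypPoly b c n).eval (v n)) atTop (𝓝 (hyp1F1 b c x)) := by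
  set R : ℝ := 1 + ‖b‖ / c.re with hR
  have hR0 : 0 ≤ R := by positivity
  have heval : ∀ n, (hypPoly b c n).eval (v n) =
      ∑' k, (n.choose k : ℂ) * (poch b k / poch c k) * v n ^ k := by
    intro n
    rw [eval_eq_sum_range' (Nat.lt_succ_of_le (natDegree_hypPoly_le b c n)),
      tsum_eq_sum (s := Finset.range (n + 1))]
    · simp only [coeff_hypPoly, Nat.succ_eq_add_one]
    · intro k hk
      rw [Nat.choose_eq_zero_of_lt (by simpa using hk)]; simp
  simp only [heval]
  rw [hyp1F1]
  refine tendsto_tsum_of_dominated_convergence (bound := fun k => (R * (‖x‖ + 1)) ^ k / k !)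
    (Real.summable_pow_div_factorial _) (fun k => ?_) ?_
  · have h1 := ((tendsto_choose_div_pow k).mul (hv.pow k)).const_mul (poch b k / poch c k)
    rw [one_div_mul_eq_div] at h1
    refine h1.congr' ?_
    filter_upwards [eventually_gt_atTop 0] with n hn
    have : (n : ℂ) ≠ 0 := by exact_mod_cast hn.ne'
    rw [mul_pow]
    field_simp
  · filter_upwards [hv.norm.eventually (eventually_le_nhds (lt_add_one ‖x‖))] with n hn k
    rw [norm_mul, norm_mul, norm_pow, mul_pow, mul_div_assoc]
    have h1 : ‖(n.choose k : ℂ)‖ * ‖v n‖ ^ k ≤ (‖x‖ + 1) ^ k / k ! := by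
      have h2 : ‖(n.choose k : ℂ)‖ ≤ (n : ℝ) ^ k / k ! := by
        rw [Complex.norm_natCast]; exact Nat.choose_le_pow_div k n
      calc ‖(n.choose k : ℂ)‖ * ‖v n‖ ^ k ≤ (n : ℝ) ^ k / k ! * ‖v n‖ ^ k := by gcongr
        _ = ((n : ℝ) * ‖v n‖) ^ k / k ! := by rw [mul_pow]; ring
        _ ≤ _ := by
          rw [norm_mul, Complex.norm_natCast] at hn
          gcongr
    calc ‖(n.choose k : ℂ)‖ * ‖poch b k / poch c k‖ * ‖v n‖ ^ k
        = ‖poch b k / poch c k‖ * (‖(n.choose k : ℂ)‖ * ‖v n‖ ^ k) := by ring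
      _ ≤ _ := by
        gcongr
        exact norm_poch_div_le b hc k

lemma conj_hyp1F1 (b c z : ℂ) : conj (hyp1F1 b c z) = hyp1F1 (conj b) (conj c) (conj z) := by
  rw [hyp1F1, hyp1F1, Complex.conj_tsum]
  congr 1; ext k
  rw [map_mul, map_div₀, map_div₀, conj_poch b, conj_poch c, map_pow, map_natCast]

/-! ### Local behaviour at `z = 1` and the size of the norms -/

lemma tendsto_mul_circPt_sub_one (θ : ℝ) :
    Tendsto (fun n : ℕ => (n : ℂ) * (circPt (θ / n) - 1)) atTop (𝓝 (Complex.I * θ)) := by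
  have hd : HasDerivAt (fun t : ℝ => Complex.exp (Complex.I * θ * t)) (Complex.I * θ) 0 := by
    have h1 : HasDerivAt (fun t : ℝ => Complex.I * θ * (t : ℂ)) (Complex.I * θ * 1) 0 :=
      (hasDerivAt_id (0 : ℝ)).ofReal_comp.const_mul _
    simpa using h1.cexp
  have h2 := (hasDerivAt_iff_tendsto_slope_zero.1 hd).comp
    (tendsto_inv_atTop_nhdsGT_zero.mono_right (nhdsWithin_mono _ fun x hx => (ne_of_gt hx)) |>.comp
      tendsto_natCast_atTop_atTop)
  refine h2.congr fun n => ?_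
  simp only [Function.comp_apply, inv_inv, zero_add, Complex.ofReal_zero, mul_zero,
    Complex.exp_zero, circPt]
  rw [Complex.real_smul]
  push_cast
  congr 3
  ring

lemma tendsto_mul_sin (θ : ℝ) :
    Tendsto (fun n : ℕ => (n : ℝ) * (2 * Real.sin (θ / n / 2))) atTop (𝓝 θ) := by
  have hd : HasDerivAt (fun t : ℝ => 2 * Real.sin (θ / 2 * t)) θ 0 := by
    have h1 : HasDerivAt (fun t : ℝ => θ / 2 * t) (θ / 2 * 1) 0 :=
      (hasDerivAt_id (0 : ℝ)).const_mul _
    have := (h1.sin).const_mul 2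
    refine this.congr_deriv ?_
    simp; ring
  have h2 := (hasDerivAt_iff_tendsto_slope_zero.1 hd).comp
    (tendsto_inv_atTop_nhdsGT_zero.mono_right (nhdsWithin_mono _ fun x hx => (ne_of_gt hx)) |>.comp
      tendsto_natCast_atTop_atTop)
  refine h2.congr fun n => ?_
  simp only [Function.comp_apply, inv_inv, zero_add, mul_zero, Real.sin_zero, sub_zero, smul_eq_mul]
  congr 3
  ring

/-- The local profile `|θ| ^ (2 Re δ) e ^ (-π Im δ sgn θ)` of the weight at `1`. -/
def weightLim (δ : ℂ) (θ : ℝ) : ℝ := |θ| ^ (2 * δ.re) * Real.exp (-(π * δ.im * Real.sign θ))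

/-- Treats both sides of the singularity at once: `x n` is `θ/n` on the right and the angle plus
`2π` on the left. The limits `∓π` of `x n - π` create the jump `e^{-π Im δ sgn θ}`. -/
lemma tendsto_rpow_mul_arcWeight {δ : ℂ} {θ : ℝ} {x : ℕ → ℝ} {y : ℝ} (hθ : 0 < θ)
    (hs : ∀ n : ℕ, Real.sin (x n / 2) = Real.sin (θ / n / 2))
    (hx : Tendsto (fun n => x n - π) atTop (𝓝 y)) :
    Tendsto (fun n : ℕ => (n : ℝ) ^ (2 * δ.re) * arcWeight δ (x n)) atTop
      (𝓝 (θ ^ (2 * δ.re) * Real.exp (δ.im * y))) := by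
  have h1 := ((tendsto_mul_sin θ).rpow_const (p := 2 * δ.re) (Or.inl hθ.ne')).mul
    ((Real.continuous_exp.tendsto _).comp (hx.const_mul δ.im))
  refine h1.congr' ?_
  have hev : ∀ᶠ n : ℕ in atTop, θ / n < 2 * π :=
    (tendsto_const_div_atTop_nhds_zero_nat θ).eventually (gt_mem_nhds (by positivity))
  filter_upwards [eventually_gt_atTop 0, hev] with n hn hn2
  have hn' : (0 : ℝ) < n := by exact_mod_cast hn
  have := sin_half_pos (div_pos hθ hn') hn2
  rw [Function.comp_apply, Real.mul_rpow hn'.le this.le, arcWeight, hs n]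
  ring

lemma tendsto_rpow_mul_weight {δ : ℂ} {θ : ℝ} (hθ : Admissible δ θ) :
    Tendsto (fun n : ℕ => (n : ℝ) ^ (2 * δ.re) * weight δ (circPt (θ / n))) atTop
      (𝓝 (weightLim δ θ)) := by
  rcases lt_trichotomy θ 0 with h | h | h
  · have h0 := tendsto_const_div_atTop_nhds_zero_nat θ
    have hx : Tendsto (fun n : ℕ => θ / n + 2 * π - π) atTop (𝓝 π) := by
      have := h0.add_const π
      rw [zero_add] at this
      refine this.congr fun n => by ring
    have h1 := tendsto_rpow_mul_arcWeight (δ := δ) (θ := -θ) (x := fun n => θ / n + 2 * π)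
      (neg_pos.2 h) (fun n => by
        rw [show (θ / n + 2 * π) / 2 = θ / n / 2 + π by ring, Real.sin_add_pi, ← Real.sin_neg]
        congr 1; ring) hx
    have e : weightLim δ θ = (-θ) ^ (2 * δ.re) * Real.exp (δ.im * π) := by
      rw [weightLim, abs_of_neg h, Real.sign_of_neg h]; congr 2; ring
    rw [e]
    refine h1.congr' ?_
    have hev : ∀ᶠ n : ℕ in atTop, -(2 * π) < θ / n :=
      h0.eventually (lt_mem_nhds (by linarith [Real.pi_pos]))
    filter_upwards [eventually_gt_atTop 0, hev] with n hn hn2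
    have hn' : (0 : ℝ) < n := by exact_mod_cast hn
    rw [weight_circPt_of_neg δ hn2 (div_neg_of_neg_of_pos h hn')]
  · subst h
    have e1 : circPt 0 = 1 := by simp [circPt]
    -- At angle `0` the sequence is `n ^ (2 Re δ)` times the conventional value at `1`.
    -- Admissibility leaves just the cases in which this value agrees with the limit profile.
    by_cases hd : δ = 0
    · subst hd
      simp [weightLim, e1, weight_one]
    · have hre : 0 < δ.re := by
        rcases hθ with h | h | h
        · exact absurd h hd
        · exact h
        · exact absurd rfl h
      simp [weightLim, e1, weight_one, hd, Real.zero_rpow (mul_pos two_pos hre).ne']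
  · have h0 := tendsto_const_div_atTop_nhds_zero_nat θ
    have hx : Tendsto (fun n : ℕ => θ / n - π) atTop (𝓝 (-π)) := by
      simpa using h0.sub_const π
    have h1 := tendsto_rpow_mul_arcWeight (δ := δ) (θ := θ) (x := fun n => θ / n) h
      (fun n => rfl) hx
    have e : weightLim δ θ = θ ^ (2 * δ.re) * Real.exp (δ.im * -π) := by
      rw [weightLim, abs_of_pos h, Real.sign_of_pos h]; congr 2; ring
    rw [e]
    refine h1.congr' ?_
    have hev : ∀ᶠ n : ℕ in atTop, θ / n < 2 * π := h0.eventually (gt_mem_nhds (by positivity))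
    filter_upwards [eventually_gt_atTop 0, hev] with n hn hn2
    have hn' : (0 : ℝ) < n := by exact_mod_cast hn
    rw [weight_circPt δ (div_pos h hn') hn2]

lemma hNorm_mul_Gamma {δ : ℂ} (hδ : -(1 / 2 : ℝ) < δ.re) (n : ℕ) :
    hNorm δ n * Real.Gamma (1 + 2 * δ.re + n) = mass δ * n ! * Real.Gamma (1 + 2 * δ.re) := by
  induction n with
  | zero => simp [hNorm]
  | succ n ih =>
    have h0 : 0 < 1 + 2 * δ.re + n := by have : (0 : ℝ) ≤ n := n.cast_nonneg; linarith
    rw [Nat.cast_succ, ← add_assoc, Real.Gamma_add_one h0.ne', Nat.factorial_succ]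
    have := hNorm_succ hδ n
    push_cast
    linear_combination Real.Gamma (1 + 2 * δ.re + n) * this + ((n : ℝ) + 1) * ih

/-- The point where the exact mass yields the constant `G(δ) / 2π` of the limiting kernel. -/
lemma mass_mul_Gamma {δ : ℂ} (hδ : -(1 / 2 : ℝ) < δ.re) :
    (mass δ * Real.Gamma (1 + 2 * δ.re))⁻¹ = gammaFactor δ / (2 * π) := by
  have hG : Complex.Gamma (1 + δ) ≠ 0 := Complex.Gamma_ne_zero_of_re_pos (by simp; linarith)
  have hG2 := Real.Gamma_pos_of_pos (show 0 < 1 + 2 * δ.re by linarith)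
  have hm := mass_pos hδ
  have := mass_eq hδ
  have hpi := Real.pi_pos
  rw [gammaFactor, div_div, inv_eq_one_div, div_eq_div_iff (by positivity) (by positivity)]
  linear_combination -Real.Gamma (1 + 2 * δ.re) * this

lemma tendsto_rpow_mul_hNorm {δ : ℂ} (hδ : -(1 / 2 : ℝ) < δ.re) :
    Tendsto (fun n : ℕ => (n : ℝ) ^ (2 * δ.re) * hNorm δ n) atTop
      (𝓝 (mass δ * Real.Gamma (1 + 2 * δ.re))) := by
  have h := (tendsto_const_nhds (x := mass δ * Real.Gamma (1 + 2 * δ.re))).div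
    (tendsto_Gamma_add_nat (show 0 < 1 + 2 * δ.re by linarith)) one_ne_zero
  rw [div_one] at h
  refine h.congr' ?_
  filter_upwards [eventually_gt_atTop 0] with n hn
  have hn' : (0 : ℝ) < n := by exact_mod_cast hn
  have h0 : 0 < 1 + 2 * δ.re + n := by linarith
  have hG := Real.Gamma_pos_of_pos h0
  have := hNorm_mul_Gamma hδ n
  rw [show 1 + 2 * δ.re - 1 = 2 * δ.re by ring]
  have hp := Real.rpow_pos_of_pos hn' (2 * δ.re)
  have hf : (n ! : ℝ) ≠ 0 := by positivity
  simp only [Pi.div_apply]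
  field_simp
  linear_combination -this

lemma tendsto_sqrt_weight_div_hNorm {δ : ℂ} (hδ : -(1 / 2 : ℝ) < δ.re) {θ τ : ℝ}
    (hθ : Admissible δ θ) (hτ : Admissible δ τ) :
    Tendsto (fun n : ℕ => √(weight δ (circPt (θ / n)) * weight δ (circPt (τ / n))) / hNorm δ n)
      atTop (𝓝 (√(weightLim δ θ * weightLim δ τ) * (gammaFactor δ / (2 * π)))) := by
  have hG2 := Real.Gamma_pos_of_pos (show 0 < 1 + 2 * δ.re by linarith)
  have hm := mass_pos hδ
  have h1 := (((tendsto_rpow_mul_weight hθ).mul (tendsto_rpow_mul_weight hτ)).sqrt).div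
    (tendsto_rpow_mul_hNorm hδ) (by positivity)
  rw [div_eq_mul_inv √(weightLim δ θ * weightLim δ τ), mass_mul_Gamma hδ] at h1
  refine h1.congr' ?_
  filter_upwards [eventually_gt_atTop 0] with n hn
  have hn' : (0 : ℝ) < n := by exact_mod_cast hn
  have hp := Real.rpow_pos_of_pos hn' (2 * δ.re)
  simp only [Pi.div_apply]
  rw [mul_mul_mul_comm, Real.sqrt_mul (by positivity), Real.sqrt_mul_self hp.le,
    mul_div_mul_left _ _ hp.ne']

lemma tendsto_gPoly {δ : ℂ} (hδ : -(1 / 2 : ℝ) < δ.re) (θ : ℝ) :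
    Tendsto (fun n : ℕ => (gPoly δ n).eval (circPt (θ / n))) atTop
      (𝓝 (conj (hyp1F1 δ (δ + conj δ + 1) (-Complex.I * θ)))) := by
  have h := tendsto_hypPoly (conj δ) (cPar_re_pos hδ) (tendsto_mul_circPt_sub_one θ)
  have e : hyp1F1 (conj δ) (cPar δ) (Complex.I * θ) =
      conj (hyp1F1 δ (δ + conj δ + 1) (-Complex.I * θ)) := by
    rw [conj_hyp1F1]
    congr 1
    · simp [cPar]; ring
    · simp
  rw [← e]
  refine h.congr fun n => ?_
  simp [gPoly, eval_comp]

lemma circPt_pow_nat_div {n : ℕ} (hn : 0 < n) (θ : ℝ) : circPt (θ / n) ^ n = circPt θ := by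
  have : (n : ℂ) ≠ 0 := by exact_mod_cast hn.ne'
  rw [circPt, circPt, ← Complex.exp_nat_mul]
  congr 1; push_cast; field_simp

lemma conj_circPt_mul_self (θ : ℝ) : conj (circPt θ) * circPt θ = 1 := by
  rw [Complex.conj_mul', norm_circPt]; simp

/-- Obtained from `gPoly` by reversal; `z ^ n = e^{iθ}` exactly at `z = e^{iθ/n}`. -/
lemma tendsto_fPoly {δ : ℂ} (hδ : -(1 / 2 : ℝ) < δ.re) (θ : ℝ) :
    Tendsto (fun n : ℕ => (fPoly δ n).eval (circPt (θ / n))) atTop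
      (𝓝 (circPt θ * hyp1F1 δ (δ + conj δ + 1) (-Complex.I * θ))) := by
  have h := ((Complex.continuous_conj.tendsto _).comp (tendsto_gPoly hδ θ)).const_mul (circPt θ)
  rw [Complex.conj_conj] at h
  refine h.congr' ?_
  filter_upwards [eventually_gt_atTop 0] with n hn
  rw [fPoly_eq_reverse hδ n (conj_circPt_mul_self _), circPt_pow_nat_div hn, Function.comp_apply]

/-! ### The scaling limit of the kernel -/

lemma sqrt_weightLim_mul (δ : ℂ) (θ τ : ℝ) : √(weightLim δ θ * weightLim δ τ) =
    (|θ| ^ δ.re * Real.exp (-(π / 2 * δ.im * Real.sign θ))) *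
      (|τ| ^ δ.re * Real.exp (-(π / 2 * δ.im * Real.sign τ))) := by
  have e : ∀ t : ℝ, weightLim δ t =
      (|t| ^ δ.re * Real.exp (-(π / 2 * δ.im * Real.sign t))) ^ 2 := fun t => by
    rw [weightLim, mul_pow, ← Real.exp_nat_mul, ← Real.rpow_natCast, ← Real.rpow_mul (abs_nonneg _)]
    congr 2
    · push_cast; ring
    · push_cast; ring
  rw [e, e, ← mul_pow, Real.sqrt_sq (by positivity)]

/-- Writing `e^{iθ}` and `e^{iτ}` as squares of half-angle exponentials makes the difference
antisymmetric: one half-angle factor goes into each `P`, and `e^{-i(θ-τ)/2}` remains outside. -/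
lemma exp_neg_mul_limKernelOff (δ : ℂ) {θ τ : ℝ} (h : θ ≠ τ) :
    ((√(weightLim δ θ * weightLim δ τ) * (gammaFactor δ / (2 * π)) : ℝ) : ℂ) *
      ((hyp1F1 δ (δ + conj δ + 1) (-Complex.I * θ) *
          conj (hyp1F1 δ (δ + conj δ + 1) (-Complex.I * τ)) -
        conj (circPt θ * hyp1F1 δ (δ + conj δ + 1) (-Complex.I * θ)) *
          (circPt τ * hyp1F1 δ (δ + conj δ + 1) (-Complex.I * τ))) /
        -(Complex.I * ((τ - θ : ℝ) : ℂ))) =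
    Complex.exp (-(Complex.I * ((θ : ℂ) - τ) / 2)) * limKernelOff δ θ τ := by
  have hne : (θ : ℂ) - τ ≠ 0 := by
    rw [← Complex.ofReal_sub]; exact_mod_cast sub_ne_zero.2 h
  have hne' : (τ : ℂ) - θ ≠ 0 := by rw [← neg_sub]; exact neg_ne_zero.2 hne
  rw [sqrt_weightLim_mul, limKernelOff, pCirc, pCirc]
  generalize hyp1F1 δ (δ + conj δ + 1) (-Complex.I * θ) = M
  generalize hyp1F1 δ (δ + conj δ + 1) (-Complex.I * τ) = N
  have hexp : ∀ t : ℝ, Complex.exp (Complex.I * t / 2 - ((π / 2 * δ.im * Real.sign t : ℝ) : ℂ)) =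
      Complex.exp (Complex.I * t / 2) * (Real.exp (-(π / 2 * δ.im * Real.sign t)) : ℝ) := fun t => by
    rw [sub_eq_add_neg, Complex.exp_add, ← Complex.ofReal_neg, Complex.ofReal_exp]
  rw [hexp, hexp]
  have hc : ∀ t : ℝ, conj (Complex.exp (Complex.I * t / 2)) = (Complex.exp (Complex.I * t / 2))⁻¹ :=
    fun t => by
      rw [← Complex.exp_conj, ← Complex.exp_neg, map_div₀, map_mul, Complex.conj_I,
        Complex.conj_ofReal, map_ofNat, neg_mul, neg_div]
  have hcirc : ∀ t : ℝ, circPt t = Complex.exp (Complex.I * t / 2) ^ 2 := fun t => by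
    rw [circPt, ← Complex.exp_nat_mul]; congr 1; push_cast; ring
  have hd : Complex.exp (-(Complex.I * ((θ : ℂ) - τ) / 2)) =
      (Complex.exp (Complex.I * θ / 2))⁻¹ * Complex.exp (Complex.I * τ / 2) := by
    rw [← Complex.exp_neg, ← Complex.exp_add]; congr 1; ring
  rw [hd, hcirc, hcirc]
  simp only [map_mul, map_pow, hc, Complex.conj_ofReal]
  have hu := Complex.exp_ne_zero (Complex.I * θ / 2)
  have hv := Complex.exp_ne_zero (Complex.I * τ / 2)
  generalize Complex.exp (Complex.I * θ / 2) = u at *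
  generalize Complex.exp (Complex.I * τ / 2) = v at *
  push_cast
  have hI := Complex.I_ne_zero
  have hpi : (π : ℂ) ≠ 0 := by exact_mod_cast Real.pi_ne_zero
  field_simp
  ring

/-- Christoffel–Darboux divided by `n (1 - conj z ζ)`, which tends to `-i (τ - θ) ≠ 0`. -/
lemma tendsto_kernel_off {δ : ℂ} (hδ : -(1 / 2 : ℝ) < δ.re) {θ τ : ℝ}
    (hθ : Admissible δ θ) (hτ : Admissible δ τ) (h : θ ≠ τ) :
    Tendsto (fun n : ℕ => (n : ℂ)⁻¹ * kernel (nweight δ) n (circPt (θ / n)) (circPt (τ / n))) atTop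
      (𝓝 (Complex.exp (-(Complex.I * ((θ : ℂ) - τ) / 2)) * limKernelOff δ θ τ)) := by
  rw [← exp_neg_mul_limKernelOff δ h]
  have h1 := (Complex.continuous_ofReal.tendsto _).comp (tendsto_sqrt_weight_div_hNorm hδ hθ hτ)
  have hg := ((Complex.continuous_conj.tendsto _).comp (tendsto_gPoly hδ θ)).mul (tendsto_gPoly hδ τ)
  have hf := ((Complex.continuous_conj.tendsto _).comp (tendsto_fPoly hδ θ)).mul (tendsto_fPoly hδ τ)
  have hd := (tendsto_mul_circPt_sub_one (τ - θ)).neg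
  have hd0 : -(Complex.I * ((τ - θ : ℝ) : ℂ)) ≠ 0 :=
    neg_ne_zero.2 (mul_ne_zero Complex.I_ne_zero (by exact_mod_cast sub_ne_zero.2 h.symm))
  rw [Complex.conj_conj] at hg
  refine (h1.mul ((hg.sub hf).div hd hd0)).congr' ?_
  filter_upwards [eventually_gt_atTop 0, hd.eventually_ne hd0] with n hn hne
  have hn' : (n : ℂ) ≠ 0 := by exact_mod_cast hn.ne'
  have hh : (hNorm δ n : ℂ) ≠ 0 := by exact_mod_cast (hNorm_pos hδ n).ne'
  have hz : conj (circPt (θ / n)) * circPt (τ / n) = circPt ((τ - θ) / n) := by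
    rw [← circPt_inv, circPt, circPt, circPt, ← Complex.exp_neg, ← Complex.exp_add]
    congr 1; push_cast; ring
  have hcd := christoffelDarboux hδ n (circPt (θ / n)) (circPt (τ / n))
  rw [hz] at hcd
  simp only [Function.comp_apply, Pi.div_apply]
  rw [hcd, kernel_nweight hδ]
  push_cast
  generalize cdKernel δ n (circPt (θ / n)) (circPt (τ / n)) = S
  generalize (√(weight δ (circPt (θ / n)) * weight δ (circPt (τ / n))) : ℂ) = W
  have h1z : 1 - circPt ((τ - θ) / n) ≠ 0 := fun h0 => hne (by
    rw [← neg_sub (circPt _) 1, neg_eq_zero] at h0; rw [h0]; simp)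
  rw [show -((n : ℂ) * (circPt ((τ - θ) / n) - 1)) = n * (1 - circPt ((τ - θ) / n)) by ring]
  field_simp

/-! ### The kernel on the diagonal -/

lemma hasDerivAt_circPt (t : ℝ) : HasDerivAt circPt (Complex.I * circPt t) t := by
  have h1 : HasDerivAt (fun t : ℝ => Complex.I * (t : ℂ)) (Complex.I * 1) t :=
    (hasDerivAt_id t).ofReal_comp.const_mul _
  refine h1.cexp.congr_deriv ?_
  rw [circPt]; ring

/-- The Christoffel–Darboux formula on the diagonal. -/
theorem christoffelDarboux_diag {δ : ℂ} (hδ : -(1 / 2 : ℝ) < δ.re) (n : ℕ) (t : ℝ) :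
    hNorm δ n * cdKernel δ n (circPt t) (circPt t) =
      n * ((gPoly δ n).eval (circPt t) * conj ((gPoly δ n).eval (circPt t))) -
        (conj ((gPoly δ n).eval (circPt t)) * (circPt t * (derivative (gPoly δ n)).eval (circPt t)) +
          (gPoly δ n).eval (circPt t) *
            conj (circPt t * (derivative (gPoly δ n)).eval (circPt t))) := by
  set z := circPt t with hz
  have hzz : conj z * z = 1 := conj_circPt_mul_self t
  -- Reversal eliminates `f`, so that only `g` and its derivative survive when the identity is
  -- differentiated in `s` at `s = t`.
  have key : ∀ s : ℝ, conj ((gPoly δ n).eval z) * (gPoly δ n).eval (circPt s) -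
      conj z ^ n * (gPoly δ n).eval z * (circPt s ^ n * conj ((gPoly δ n).eval (circPt s))) =
      hNorm δ n * (1 - conj z * circPt s) * cdKernel δ n z (circPt s) := fun s => by
    rw [← christoffelDarboux hδ, fPoly_eq_reverse hδ n (conj_circPt_mul_self s),
      fPoly_eq_reverse hδ n hzz]
    simp only [map_mul, map_pow, Complex.conj_conj]
  have hc := hasDerivAt_circPt t
  rw [← hz] at hc
  have hg : HasDerivAt (fun s => (gPoly δ n).eval (circPt s))
      ((derivative (gPoly δ n)).eval z * (Complex.I * z)) t :=
    HasDerivAt.comp (h₂ := fun x => (gPoly δ n).eval x) t ((gPoly δ n).hasDerivAt _) hc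
  have hgc : HasDerivAt (fun s => conj ((gPoly δ n).eval (circPt s)))
      (conj ((derivative (gPoly δ n)).eval z * (Complex.I * z))) t :=
    Complex.conjCLE.hasFDerivAt.comp_hasDerivAt t hg
  have hl := (hg.const_mul (conj ((gPoly δ n).eval z))).sub
    (((hc.pow n).mul hgc).const_mul (conj z ^ n * (gPoly δ n).eval z))
  -- Only differentiability is needed: the factor `1 - conj z ζ` vanishes at `s = t` and kills this
  -- derivative.
  have hS : ∃ S', HasDerivAt (fun s => cdKernel δ n z (circPt s)) S' t := by
    refine ⟨_, HasDerivAt.fun_sum (A' := fun l => conj ((fPoly δ l).eval z) *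
      ((derivative (fPoly δ l)).eval z * (Complex.I * z)) / (hNorm δ l : ℂ)) fun l _ => ?_⟩
    exact ((HasDerivAt.comp (h₂ := fun x => (fPoly δ l).eval x) t
      ((fPoly δ l).hasDerivAt _) hc).const_mul _).div_const _
  obtain ⟨S', hS⟩ := hS
  have hr := ((hc.const_mul (conj z)).const_sub 1 |>.const_mul (hNorm δ n : ℂ)).mul hS
  have he := hl.unique (hr.congr_of_eventuallyEq (Eventually.of_forall fun s => key s))
  simp only [← hz, hzz, sub_self, mul_zero, zero_mul, add_zero, Pi.pow_apply] at he
  rw [map_mul, map_mul, Complex.conj_I] at he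
  have hzn : conj z ^ n * z ^ n = 1 := by rw [← mul_pow, hzz, one_pow]
  have hn : (n : ℂ) * z ^ (n - 1) * z = n * z ^ n := by
    rcases n with _ | n
    · simp
    · rw [Nat.add_sub_cancel, pow_succ]; ring
  apply mul_left_cancel₀ Complex.I_ne_zero
  rw [map_mul]
  linear_combination he - Complex.I * hNorm δ n * cdKernel δ n z z * hzz +
    Complex.I * (gPoly δ n).eval z * conj ((gPoly δ n).eval z) * conj z ^ n * hn +
    (Complex.I * (gPoly δ n).eval z * conj ((gPoly δ n).eval z) * n -
      Complex.I * (gPoly δ n).eval z * conj z * conj ((derivative (gPoly δ n)).eval z)) * hzn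

lemma eval_derivative_gPoly (δ : ℂ) (n : ℕ) (z : ℂ) :
    (derivative (gPoly δ (n + 1))).eval z =
      (n + 1) * (conj δ / cPar δ) * (hypPoly (conj δ + 1) (cPar δ + 1) n).eval (z - 1) := by
  rw [gPoly, derivative_comp, derivative_hypPoly]
  simp [eval_comp]

lemma tendsto_derivative_gPoly {δ : ℂ} (hδ : -(1 / 2 : ℝ) < δ.re) (θ : ℝ) :
    Tendsto (fun n : ℕ => (n : ℂ)⁻¹ *
        (circPt (θ / n) * (derivative (gPoly δ n)).eval (circPt (θ / n)))) atTop
      (𝓝 (conj δ / (δ + conj δ + 1) *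
        hyp1F1 (conj δ + 1) (δ + conj δ + 2) (Complex.I * θ))) := by
  have hc : 0 < (cPar δ + 1).re := by
    rw [Complex.add_re, Complex.one_re]; linarith [cPar_re_pos hδ]
  have h0 := (tendsto_mul_circPt_sub_one θ).comp (tendsto_add_atTop_nat 1)
  have hz : Tendsto (fun n : ℕ => circPt (θ / (n + 1 : ℕ))) atTop (𝓝 1) := by
    have h2 : Tendsto (fun n : ℕ => θ / (n : ℝ)) atTop (𝓝 0) :=
      tendsto_const_div_atTop_nhds_zero_nat θ
    have h1 := ((continuous_circPt.tendsto 0).comp h2).comp (tendsto_add_atTop_nat 1)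
    have e : circPt 0 = 1 := by simp [circPt]
    rwa [e] at h1
  -- Differentiation lowers the degree to `n` while the point is `e^{iθ/(n+1)}`; the discrepancy `z
  -- - 1` between the scalings `n` and `n + 1` tends to zero.
  have hv : Tendsto (fun n : ℕ => (n : ℂ) * (circPt (θ / (n + 1 : ℕ)) - 1)) atTop
      (𝓝 (Complex.I * θ)) := by
    have h1 := h0.sub (hz.sub_const 1)
    rw [sub_self, sub_zero] at h1
    refine h1.congr fun n => ?_
    simp only [Function.comp_apply]
    push_cast; ring
  have h1 := hz.mul ((tendsto_hypPoly (conj δ + 1) hc hv).const_mul (conj δ / cPar δ))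
  rw [one_mul] at h1
  rw [show δ + conj δ + 2 = cPar δ + 1 by rw [cPar]; ring,
    show δ + conj δ + 1 = cPar δ by rw [cPar]; ring]
  refine (tendsto_add_atTop_iff_nat 1).1 (h1.congr fun n => ?_)
  have hn : ((n : ℂ) + 1) ≠ 0 := by exact_mod_cast n.succ_ne_zero
  rw [eval_derivative_gPoly]
  push_cast
  field_simp

lemma tendsto_kernel_diag {δ : ℂ} (hδ : -(1 / 2 : ℝ) < δ.re) {θ : ℝ} (hθ : Admissible δ θ) :
    Tendsto (fun n : ℕ => (n : ℂ)⁻¹ * kernel (nweight δ) n (circPt (θ / n)) (circPt (θ / n))) atTop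
      (𝓝 (limKernelDiag δ θ : ℂ)) := by
  have h1 := (Complex.continuous_ofReal.tendsto _).comp (tendsto_sqrt_weight_div_hNorm hδ hθ hθ)
  have hg := tendsto_gPoly hδ θ
  have hgc := (Complex.continuous_conj.tendsto _).comp hg
  have hd := tendsto_derivative_gPoly hδ θ
  have hdc := (Complex.continuous_conj.tendsto _).comp hd
  have h2 := h1.mul ((hg.mul hgc).sub ((hgc.mul hd).add (hg.mul hdc)))
  have e : (limKernelDiag δ θ : ℂ) =
      ((√(weightLim δ θ * weightLim δ θ) * (gammaFactor δ / (2 * π)) : ℝ) : ℂ) *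
      (conj (hyp1F1 δ (δ + conj δ + 1) (-Complex.I * θ)) *
          conj (conj (hyp1F1 δ (δ + conj δ + 1) (-Complex.I * θ))) -
        (conj (conj (hyp1F1 δ (δ + conj δ + 1) (-Complex.I * θ))) *
          (conj δ / (δ + conj δ + 1) * hyp1F1 (conj δ + 1) (δ + conj δ + 2) (Complex.I * θ)) +
          conj (hyp1F1 δ (δ + conj δ + 1) (-Complex.I * θ)) *
            conj (conj δ / (δ + conj δ + 1) *
              hyp1F1 (conj δ + 1) (δ + conj δ + 2) (Complex.I * θ)))) := by
    have hM : hyp1F1 (conj δ) (δ + conj δ + 1) (Complex.I * θ) =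
        conj (hyp1F1 δ (δ + conj δ + 1) (-Complex.I * θ)) := by
      rw [conj_hyp1F1]; congr 1
      · simp [add_comm]
      · simp
    have hw : 0 ≤ weightLim δ θ := by rw [weightLim]; positivity
    rw [limKernelDiag, hM, Real.sqrt_mul_self hw, weightLim]
    generalize hyp1F1 δ (δ + conj δ + 1) (-Complex.I * θ) = M
    have hK : M * (conj M - 2 * (conj δ / (δ + conj δ + 1)) *
        hyp1F1 (conj δ + 1) (δ + conj δ + 2) (Complex.I * θ)) =
        M * (conj M - 2 * (conj δ / (δ + conj δ + 1) *
        hyp1F1 (conj δ + 1) (δ + conj δ + 2) (Complex.I * θ))) := by ring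
    rw [hK]
    generalize conj δ / (δ + conj δ + 1) *
      hyp1F1 (conj δ + 1) (δ + conj δ + 2) (Complex.I * θ) = D
    rw [Complex.ofReal_mul, Complex.re_eq_add_conj]
    simp only [map_mul, map_sub, Complex.conj_conj, map_ofNat]
    push_cast
    ring
  rw [e]
  refine h2.congr' ?_
  filter_upwards [eventually_gt_atTop 0] with n hn
  have hn' : (n : ℂ) ≠ 0 := by exact_mod_cast hn.ne'
  have hh : (hNorm δ n : ℂ) ≠ 0 := by exact_mod_cast (hNorm_pos hδ n).ne'
  have hcd := christoffelDarboux_diag hδ n (θ / n)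
  simp only [Function.comp_apply]
  rw [kernel_nweight hδ, map_mul, map_inv₀, map_natCast]
  have hS : cdKernel δ n (circPt (θ / n)) (circPt (θ / n)) = _ / (hNorm δ n : ℂ) :=
    (eq_div_iff hh).2 ((mul_comm _ _).trans hcd)
  rw [hS]
  push_cast
  field_simp

/-- The scaling limit of the kernel at the Fisher–Hartwig singularity. -/
theorem tendsto_kernel {δ : ℂ} (hδ : -(1 / 2 : ℝ) < δ.re) {θ τ : ℝ}
    (hθ : Admissible δ θ) (hτ : Admissible δ τ) :
    Tendsto (fun n : ℕ => (n : ℂ)⁻¹ * kernel (nweight δ) n (circPt (θ / n)) (circPt (τ / n))) atTop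
      (𝓝 (Complex.exp (-(Complex.I * ((θ : ℂ) - τ) / 2)) * limKernel δ θ τ)) := by
  by_cases h : θ = τ
  · subst h
    rw [limKernel, if_pos rfl, sub_self, mul_zero, zero_div, neg_zero, Complex.exp_zero, one_mul]
    exact tendsto_kernel_diag hδ hθ
  · rw [limKernel, if_neg h]
    exact tendsto_kernel_off hδ hθ hτ h

theorem pCirc_eq_pReal (δ : ℂ) {θ : ℝ} (hθ : θ ≠ 0) : pCirc δ θ = pReal δ (-2 * θ⁻¹) := by
  have hc : (θ : ℂ) ≠ 0 := by exact_mod_cast hθ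
  have h1 : |2 / (-2 * θ⁻¹)| = |θ| := by
    rw [show 2 / (-2 * θ⁻¹) = -θ by field_simp, abs_neg]
  have h2 : Real.sign (-2 * θ⁻¹) = -Real.sign θ := by
    rcases lt_or_gt_of_ne hθ with h | h
    · have := inv_lt_zero.2 h
      rw [Real.sign_of_neg h, Real.sign_of_pos (by linarith), neg_neg]
    · have := inv_pos.2 h
      rw [Real.sign_of_pos h, Real.sign_of_neg (by linarith)]
  rw [pCirc, pReal, h1, h2]
  congr 2
  · congr 1
    push_cast
    field_simp
    ring
  · push_cast
    field_simp

/-! ### Determinants of reproducing kernels -/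

/-- The Schur complement formula needs `A` invertible. Since `A + ε` is singular only when `ε` is a
root of the characteristic polynomial of `-A`, the identity holds for a dense set of `ε` and extends
to `ε = 0` by continuity. -/
lemma det_bordered {m : ℕ} (A : Matrix (Fin m) (Fin m) ℂ) (b c : Fin m → ℂ) (d : ℂ) :
    (Matrix.fromBlocks A (Matrix.of fun i (_ : Fin 1) => b i) (Matrix.of fun (_ : Fin 1) j => c j)
      (Matrix.of fun _ _ => d)).det =
      d * A.det - ∑ i, ∑ j, c i * A.adjugate i j * b j := by
  have hcont : ∀ (F : ℂ → Matrix (Fin m) (Fin m) ℂ), Continuous F →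
      Continuous fun ε => d * (F ε).det - ∑ i, ∑ j, c i * (F ε).adjugate i j * b j := fun F hF => by
    have h2 : Continuous fun ε => (F ε).adjugate := hF.matrix_adjugate
    refine (continuous_const.mul hF.matrix_det).sub (continuous_finsetSum _ fun i _ =>
      continuous_finsetSum _ fun j _ =>
        (continuous_const.mul (h2.matrix_elem i j)).mul continuous_const)
  have hF : Continuous fun ε : ℂ => Matrix.scalar (Fin m) ε - (-A) := by
    refine Continuous.sub ?_ continuous_const
    change Continuous fun ε : ℂ => Matrix.diagonal fun _ : Fin m => ε
    exact Continuous.matrix_diagonal (by fun_prop)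
  have h1 : Continuous fun ε : ℂ => (Matrix.fromBlocks (Matrix.scalar (Fin m) ε - (-A))
      (Matrix.of fun i (_ : Fin 1) => b i) (Matrix.of fun (_ : Fin 1) j => c j)
      (Matrix.of fun _ _ => d)).det :=
    (Continuous.matrix_fromBlocks hF continuous_const continuous_const continuous_const).matrix_det
  have hdense : Dense {ε : ℂ | (-A).charpoly.eval ε ≠ 0} := by
    have hfin : ((-A).charpoly.roots.toFinset : Set ℂ).Finite := Finset.finite_toSet _
    refine (hfin.countable.dense_compl ℂ).mono fun ε hε => ?_
    intro h0
    apply hε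
    simp only [Finset.mem_coe, Multiset.mem_toFinset]
    exact (mem_roots (-A).charpoly_monic.ne_zero).2 h0
  have key := Continuous.ext_on hdense h1 (hcont _ hF) (fun ε hε => ?_)
  · have := congrFun key 0
    simpa using this
  · have hdet : (Matrix.scalar (Fin m) ε - (-A)).det ≠ 0 := by
      rw [← Matrix.eval_charpoly]; exact hε
    generalize Matrix.scalar (Fin m) ε - (-A) = B at *
    let _ := B.invertibleOfIsUnitDet (isUnit_iff_ne_zero.2 hdet)
    rw [Matrix.det_fromBlocks₁₁, Matrix.det_fin_one, Matrix.invOf_eq_nonsing_inv, Matrix.inv_def,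
      Ring.inverse_eq_inv']
    simp only [Matrix.sub_apply, Matrix.of_apply, Matrix.mul_apply, Matrix.smul_apply, smul_eq_mul]
    rw [mul_sub, mul_comm]
    congr 1
    rw [Finset.mul_sum]
    simp only [Finset.sum_mul, Finset.mul_sum]
    rw [Finset.sum_comm]
    refine Finset.sum_congr rfl fun i _ => Finset.sum_congr rfl fun j _ => ?_
    field_simp

/-- The determinant of the matrix of values of a kernel. -/
def kdet (K : ℝ → ℝ → ℂ) {m : ℕ} (X : Fin m → ℝ) : ℂ :=
  (Matrix.of fun i j => K (X i) (X j)).det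

lemma kdet_snoc (K : ℝ → ℝ → ℂ) {m : ℕ} (X : Fin m → ℝ) (t : ℝ) :
    kdet K (Fin.snoc X t : Fin (m + 1) → ℝ) = K t t * kdet K X -
      ∑ i, ∑ j, K t (X i) * (Matrix.of fun i j => K (X i) (X j)).adjugate i j * K (X j) t := by
  rw [kdet, kdet, ← det_bordered, ← Matrix.det_submatrix_equiv_self finSumFinEquiv]
  congr 1
  ext i j
  rcases i with i | i <;> rcases j with j | j
  · simp only [Matrix.submatrix_apply, Matrix.of_apply, Matrix.fromBlocks_apply₁₁,
      finSumFinEquiv_apply_left]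
    erw [Fin.snoc_castSucc, Fin.snoc_castSucc]
  · obtain rfl := Subsingleton.elim j 0
    simp only [Matrix.submatrix_apply, Matrix.of_apply, Matrix.fromBlocks_apply₁₂,
      finSumFinEquiv_apply_left, finSumFinEquiv_apply_right]
    erw [Fin.snoc_castSucc, Fin.snoc_last]
  · obtain rfl := Subsingleton.elim i 0
    simp only [Matrix.submatrix_apply, Matrix.of_apply, Matrix.fromBlocks_apply₂₁,
      finSumFinEquiv_apply_left, finSumFinEquiv_apply_right]
    erw [Fin.snoc_castSucc, Fin.snoc_last]
  · obtain rfl := Subsingleton.elim i 0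
    obtain rfl := Subsingleton.elim j 0
    simp only [Matrix.submatrix_apply, Matrix.of_apply, Matrix.fromBlocks_apply₂₂,
      finSumFinEquiv_apply_right]
    erw [Fin.snoc_last]

lemma continuous_kdet {K : ℝ → ℝ → ℂ} (hK : Continuous fun p : ℝ × ℝ => K p.1 p.2) (m : ℕ) :
    Continuous fun X : Fin m → ℝ => kdet K X := by
  refine Continuous.matrix_det (continuous_matrix fun i j => ?_)
  exact Continuous.comp (g := fun p : ℝ × ℝ => K p.1 p.2) hK
    (f := fun X : Fin m → ℝ => (X i, X j)) (by fun_prop)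

/-- Integrating out one variable from the determinant of a reproducing kernel. -/
theorem integral_kdet_snoc {μ : Measure ℝ} {W : ℝ → ℝ} {K : ℝ → ℝ → ℂ} {N : ℂ}
    (hint : ∀ x y, Integrable (fun t => (W t : ℂ) * (K x t * K t y)) μ)
    (hdiag : Integrable (fun t => (W t : ℂ) * K t t) μ)
    (hrep : ∀ x y, ∫ t, (W t : ℂ) * (K x t * K t y) ∂μ = K x y)
    (htr : ∫ t, (W t : ℂ) * K t t ∂μ = N) {m : ℕ} (X : Fin m → ℝ) :
    ∫ t, (W t : ℂ) * kdet K (Fin.snoc X t : Fin (m + 1) → ℝ) ∂μ = (N - m) * kdet K X := by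
  set A : Matrix (Fin m) (Fin m) ℂ := Matrix.of fun i j => K (X i) (X j) with hA
  have e : ∀ t, (W t : ℂ) * kdet K (Fin.snoc X t : Fin (m + 1) → ℝ) =
      kdet K X * ((W t : ℂ) * K t t) -
        ∑ i, ∑ j, A.adjugate i j * ((W t : ℂ) * (K (X j) t * K t (X i))) := fun t => by
    rw [kdet_snoc, mul_sub, Finset.mul_sum]
    simp only [Finset.mul_sum]
    congr 1
    · ring
    · exact Finset.sum_congr rfl fun i _ => Finset.sum_congr rfl fun j _ => by ring
  have hi : ∀ i j, Integrable
      (fun t => A.adjugate i j * ((W t : ℂ) * (K (X j) t * K t (X i)))) μ :=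
    fun i j => (hint _ _).const_mul _
  have hs : ∀ i, Integrable
      (fun t => ∑ j, A.adjugate i j * ((W t : ℂ) * (K (X j) t * K t (X i)))) μ :=
    fun i => integrable_finsetSum _ fun j _ => hi i j
  have hs2 : ∫ t, ∑ i, ∑ j, A.adjugate i j * ((W t : ℂ) * (K (X j) t * K t (X i))) ∂μ =
      ∑ i, ∑ j, A.adjugate i j * K (X j) (X i) := by
    rw [integral_finsetSum _ fun i _ => hs i]
    refine Finset.sum_congr rfl fun i _ => ?_
    rw [integral_finsetSum _ fun j _ => hi i j]
    refine Finset.sum_congr rfl fun j _ => ?_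
    rw [integral_const_mul, hrep]
  rw [integral_congr_ae (ae_of_all _ e),
    integral_sub (hdiag.const_mul _) (integrable_finsetSum _ fun i _ => hs i),
    integral_const_mul, htr, hs2]
  -- After the reproducing property the double sum is `tr (adj A · A) = m det A`, whence the factor
  -- `N - m`.
  have h2 : ∑ i, ∑ j, A.adjugate i j * K (X j) (X i) = m * kdet K X := by
    have h3 := congrArg Matrix.trace A.adjugate_mul
    rw [Matrix.trace_smul, Matrix.trace_one, Fintype.card_fin, smul_eq_mul, mul_comm] at h3
    rw [kdet, ← hA, ← h3]
    simp only [Matrix.trace, Matrix.diag, Matrix.mul_apply, hA, Matrix.of_apply]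
  rw [h2]
  ring

/-! ### Integration over boxes -/

lemma volume_restrict_angleBox (N : ℕ) :
    (volume : Measure (Fin N → ℝ)).restrict (angleBox N) =
      Measure.pi fun _ => (volume : Measure ℝ).restrict (Set.Ioc (-π) π) := by
  rw [angleBox, volume_pi, Measure.restrict_pi_pi]

/-- The splitting of the last coordinate. -/
lemma measurePreserving_snoc (N : ℕ) :
    MeasurePreserving (MeasurableEquiv.piFinSuccAbove (fun _ => ℝ) (Fin.last N)).symm
      (((volume : Measure ℝ).restrict (Set.Ioc (-π) π)).prod
        ((volume : Measure (Fin N → ℝ)).restrict (angleBox N)))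
      ((volume : Measure (Fin (N + 1) → ℝ)).restrict (angleBox (N + 1))) := by
  rw [volume_restrict_angleBox, volume_restrict_angleBox]
  exact (measurePreserving_piFinSuccAbove
    (fun _ => (volume : Measure ℝ).restrict (Set.Ioc (-π) π)) (Fin.last N)).symm

lemma piFinSuccAbove_last_symm {N : ℕ} (p : ℝ × (Fin N → ℝ)) :
    (MeasurableEquiv.piFinSuccAbove (fun _ => ℝ) (Fin.last N)).symm p =
      (Fin.snoc p.2 p.1 : Fin (N + 1) → ℝ) := by
  change Fin.insertNth (α := fun _ => ℝ) (Fin.last N) p.1 p.2 = _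
  rw [Fin.insertNth_last']

lemma integral_angleBox_succ {N : ℕ} {F : (Fin (N + 1) → ℝ) → ℂ}
    (hF : IntegrableOn F (angleBox (N + 1))) :
    ∫ y in angleBox (N + 1), F y =
      ∫ y in angleBox N, ∫ t in Set.Ioc (-π) π, F (Fin.snoc y t : Fin (N + 1) → ℝ) := by
  have h := measurePreserving_snoc N
  have hi := (h.integrable_comp_emb (MeasurableEquiv.measurableEmbedding _)).2 hF
  simp only [Function.comp_def] at hi
  rw [← h.integral_comp', integral_prod_symm _ hi]
  simp only [piFinSuccAbove_last_symm]

/-- Concatenation of tuples as a measurable equivalence. -/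
def appendEquiv (m k : ℕ) : ((Fin m → ℝ) × (Fin k → ℝ)) ≃ᵐ (Fin (m + k) → ℝ) :=
  (MeasurableEquiv.sumPiEquivProdPi (fun _ : Fin m ⊕ Fin k => ℝ)).symm.trans
    (MeasurableEquiv.piCongrLeft (fun _ : Fin (m + k) => ℝ) finSumFinEquiv)

lemma appendEquiv_apply {m k : ℕ} (p : (Fin m → ℝ) × (Fin k → ℝ)) :
    appendEquiv m k p = Fin.append p.1 p.2 := by
  ext i
  obtain ⟨j, rfl⟩ := finSumFinEquiv.surjective i
  rw [appendEquiv, MeasurableEquiv.trans_apply, MeasurableEquiv.coe_piCongrLeft,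
    Equiv.piCongrLeft_apply_apply]
  rcases j with j | j
  · simp [MeasurableEquiv.coe_sumPiEquivProdPi_symm, Equiv.sumPiEquivProdPi]
  · simp [MeasurableEquiv.coe_sumPiEquivProdPi_symm, Equiv.sumPiEquivProdPi]

lemma measurePreserving_appendEquiv (m k : ℕ) :
    MeasurePreserving (appendEquiv m k)
      (((volume : Measure (Fin m → ℝ)).restrict (angleBox m)).prod
        ((volume : Measure (Fin k → ℝ)).restrict (angleBox k)))
      ((volume : Measure (Fin (m + k) → ℝ)).restrict (angleBox (m + k))) := by
  rw [volume_restrict_angleBox, volume_restrict_angleBox, volume_restrict_angleBox]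
  exact (measurePreserving_piCongrLeft
    (fun _ : Fin (m + k) => (volume : Measure ℝ).restrict (Set.Ioc (-π) π)) finSumFinEquiv).comp
    (measurePreserving_sumPiEquivProdPi_symm
      (fun _ : Fin m ⊕ Fin k => (volume : Measure ℝ).restrict (Set.Ioc (-π) π)))

lemma integral_angleBox_append {m k : ℕ} {F : (Fin (m + k) → ℝ) → ℝ}
    (hF : IntegrableOn F (angleBox (m + k))) :
    ∫ y in angleBox (m + k), F y =
      ∫ x in angleBox m, ∫ y in angleBox k, F (Fin.append x y) := by
  have h := measurePreserving_appendEquiv m k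
  have hi := (h.integrable_comp_emb (MeasurableEquiv.measurableEmbedding _)).2 hF
  simp only [Function.comp_def] at hi
  rw [← h.integral_comp', integral_prod _ hi]
  simp only [appendEquiv_apply]

lemma integral_angleBox_perm {N : ℕ} (σ : Equiv.Perm (Fin N)) (F : (Fin N → ℝ) → ℝ) :
    ∫ y in angleBox N, F (y ∘ σ) = ∫ y in angleBox N, F y := by
  have h := measurePreserving_piCongrLeft
    (fun _ : Fin N => (volume : Measure ℝ).restrict (Set.Ioc (-π) π)) σ
  rw [volume_restrict_angleBox, ← h.integral_comp']
  congr 1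
  ext y
  congr 1
  ext i
  exact Equiv.piCongrLeft_apply_apply (P := fun _ : Fin N => ℝ) σ y i

/-- The weight may be unbounded, but the product of its one-variable copies is integrable and a
continuous factor is bounded on the closed cube. -/
lemma integrableOn_prod_mul {w : ℝ → ℝ} (hw : IntegrableOn w (Set.Ioc (-π) π)) {N : ℕ}
    {F : (Fin N → ℝ) → ℂ} (hF : Continuous F) :
    IntegrableOn (fun y => ((∏ i, w (y i) : ℝ) : ℂ) * F y) (angleBox N) := by
  have h1 : IntegrableOn (fun y : Fin N → ℝ => ∏ i, w (y i)) (angleBox N) := by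
    rw [IntegrableOn, volume_restrict_angleBox]
    exact Integrable.fintype_prod fun _ => hw
  have hK : IsCompact (Set.univ.pi fun _ : Fin N => Set.Icc (-π) π) :=
    isCompact_univ_pi fun _ => isCompact_Icc
  obtain ⟨c, hc⟩ := hK.exists_bound_of_continuousOn hF.continuousOn
  refine Integrable.mul_bdd (c := c) h1.ofReal hF.aestronglyMeasurable ?_
  rw [angleBox, ae_restrict_iff' (MeasurableSet.univ_pi fun _ => measurableSet_Ioc)]
  exact Eventually.of_forall fun y hy => hc y fun i hi => Set.Ioc_subset_Icc_self (hy i hi)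

/-- Integrating out several variables from the determinant of a reproducing kernel. -/
theorem integral_kdet_append {W : ℝ → ℝ} {K : ℝ → ℝ → ℂ} {n : ℕ}
    (hK : Continuous fun p : ℝ × ℝ => K p.1 p.2) (hW : IntegrableOn W (Set.Ioc (-π) π))
    (hint : ∀ x y, IntegrableOn (fun t => (W t : ℂ) * (K x t * K t y)) (Set.Ioc (-π) π))
    (hdiag : IntegrableOn (fun t => (W t : ℂ) * K t t) (Set.Ioc (-π) π))
    (hrep : ∀ x y, ∫ t in Set.Ioc (-π) π, (W t : ℂ) * (K x t * K t y) = K x y)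
    (htr : ∫ t in Set.Ioc (-π) π, (W t : ℂ) * K t t = n) {m : ℕ} (x : Fin m → ℝ) (k : ℕ)
    (hk : m + k ≤ n) :
    ∫ y in angleBox k, ((∏ i, W (y i) : ℝ) : ℂ) * kdet K (Fin.append x y) =
      ((n - m).descFactorial k : ℂ) * kdet K x := by
  induction k with
  | zero =>
    -- Over zero variables the measure is a unit point mass.
    have h1 : angleBox 0 = Set.univ := Set.eq_univ_of_forall fun y i => i.elim0
    rw [h1, Measure.restrict_univ, volume_pi, Measure.pi_of_empty _ (fun i => i.elim0),
      integral_dirac]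
    simp [Fin.append_elim0]
  | succ k ih =>
    have hcont : ∀ k, Continuous fun y : Fin k → ℝ => kdet K (Fin.append x y) := fun k =>
      (continuous_kdet hK (m + k)).comp (by
        refine continuous_pi fun i => ?_
        refine Fin.addCases (fun j => ?_) (fun j => ?_) i
        · simp only [Fin.append_left]; exact continuous_const
        · simp only [Fin.append_right]; exact continuous_apply j)
    rw [integral_angleBox_succ (integrableOn_prod_mul hW (hcont (k + 1)))]
    have e : ∀ y : Fin k → ℝ, ∫ t in Set.Ioc (-π) π,
        ((∏ i, W ((Fin.snoc y t : Fin (k + 1) → ℝ) i) : ℝ) : ℂ) *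
          kdet K (Fin.append x (Fin.snoc y t : Fin (k + 1) → ℝ)) =
        ((n : ℂ) - (m + k : ℕ)) * (((∏ i, W (y i) : ℝ) : ℂ) * kdet K (Fin.append x y)) := by
      intro y
      have h1 := integral_kdet_snoc hint hdiag hrep htr (Fin.append x y)
      rw [mul_left_comm, ← h1, ← integral_const_mul]
      congr 1
      ext t
      rw [Fin.prod_univ_castSucc, Fin.append_snoc]
      simp only [Fin.snoc_castSucc, Fin.snoc_last]
      push_cast
      rw [mul_assoc]
    simp only [e]
    rw [integral_const_mul, ih (by omega), Nat.descFactorial_succ]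
    have : ((n - m - k : ℕ) : ℂ) = (n : ℂ) - (m + k : ℕ) := by
      rw [Nat.sub_sub, Nat.cast_sub (by omega)]
    rw [Nat.cast_mul, this]
    ring

/-! ### The determinantal formula for the correlation functions -/

/-- The Christoffel–Darboux kernel in angular variables. -/
def angKernel (δ : ℂ) (n : ℕ) (x y : ℝ) : ℂ := cdKernel δ n (circPt x) (circPt y)

lemma continuous_eval_circPt (p : ℂ[X]) : Continuous fun t : ℝ => p.eval (circPt t) :=
  p.continuous.comp continuous_circPt

lemma continuous_angKernel (δ : ℂ) (n : ℕ) :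
    Continuous fun p : ℝ × ℝ => angKernel δ n p.1 p.2 := by
  unfold angKernel cdKernel
  refine continuous_finsetSum _ fun l _ => Continuous.div_const ?_ _
  exact (Complex.continuous_conj.comp ((continuous_eval_circPt _).comp continuous_fst)).mul
    ((continuous_eval_circPt _).comp continuous_snd)

lemma integrableOn_weight {δ : ℂ} (hδ : -(1 / 2 : ℝ) < δ.re) :
    IntegrableOn (fun t => weight δ (circPt t)) (Set.Ioc (-π) π) :=
  (intervalIntegrable_weight hδ (-π) π).1

lemma integrableOn_weight_mul {δ : ℂ} (hδ : -(1 / 2 : ℝ) < δ.re) {F : ℝ → ℂ} (hF : Continuous F) :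
    IntegrableOn (fun t => (weight δ (circPt t) : ℂ) * F t) (Set.Ioc (-π) π) := by
  have h : IntervalIntegrable (fun t => (weight δ (circPt t) : ℂ)) volume (-π) π :=
    ⟨(intervalIntegrable_weight hδ (-π) π).1.ofReal, (intervalIntegrable_weight hδ (-π) π).2.ofReal⟩
  exact (h.mul_continuousOn hF.continuousOn).1

lemma setIntegral_fPoly {δ : ℂ} (hδ : -(1 / 2 : ℝ) < δ.re) (l k : ℕ) :
    ∫ t in Set.Ioc (-π) π, (weight δ (circPt t) : ℂ) *
      (conj ((fPoly δ l).eval (circPt t)) * (fPoly δ k).eval (circPt t)) =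
      if l = k then (hNorm δ k : ℂ) else 0 := by
  rw [← circInner_fPoly hδ, circInner,
    intervalIntegral.integral_of_le (by linarith [Real.pi_pos])]
  congr 1; ext t; ring

lemma continuous_conj_mul_fPoly (δ : ℂ) (l k : ℕ) : Continuous fun t : ℝ =>
    conj ((fPoly δ l).eval (circPt t)) * (fPoly δ k).eval (circPt t) :=
  (Complex.continuous_conj.comp (continuous_eval_circPt _)).mul (continuous_eval_circPt _)

lemma integral_angKernel_mul {δ : ℂ} (hδ : -(1 / 2 : ℝ) < δ.re) (n : ℕ) (x y : ℝ) :
    ∫ t in Set.Ioc (-π) π, (weight δ (circPt t) : ℂ) * (angKernel δ n x t * angKernel δ n t y) =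
      angKernel δ n x y := by
  have e : ∀ t, (weight δ (circPt t) : ℂ) * (angKernel δ n x t * angKernel δ n t y) =
      ∑ l ∈ Finset.range n, ∑ k ∈ Finset.range n,
        (conj ((fPoly δ l).eval (circPt x)) * (fPoly δ k).eval (circPt y) /
          (hNorm δ l * hNorm δ k)) * ((weight δ (circPt t) : ℂ) *
          (conj ((fPoly δ k).eval (circPt t)) * (fPoly δ l).eval (circPt t))) := by
    intro t
    rw [angKernel, angKernel, cdKernel, cdKernel, Finset.sum_mul_sum, Finset.mul_sum]
    refine Finset.sum_congr rfl fun l _ => ?_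
    rw [Finset.mul_sum]
    refine Finset.sum_congr rfl fun k _ => ?_
    ring
  have hi : ∀ l k, IntegrableOn (fun t =>
      (conj ((fPoly δ l).eval (circPt x)) * (fPoly δ k).eval (circPt y) /
          (hNorm δ l * hNorm δ k)) * ((weight δ (circPt t) : ℂ) *
          (conj ((fPoly δ k).eval (circPt t)) * (fPoly δ l).eval (circPt t))))
      (Set.Ioc (-π) π) := fun l k =>
    (integrableOn_weight_mul hδ (continuous_conj_mul_fPoly δ k l)).const_mul _
  rw [integral_congr_ae (ae_of_all _ e),
    integral_finsetSum _ fun l _ => integrable_finsetSum _ fun k _ => hi l k, angKernel, cdKernel]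
  refine Finset.sum_congr rfl fun l hl => ?_
  rw [integral_finsetSum _ fun k _ => hi l k]
  simp only [integral_const_mul, setIntegral_fPoly hδ]
  rw [Finset.sum_eq_single_of_mem l hl fun k _ hk => by rw [if_neg hk, mul_zero], if_pos rfl]
  have hh : (hNorm δ l : ℂ) ≠ 0 := by exact_mod_cast (hNorm_pos hδ l).ne'
  field_simp

lemma integral_angKernel_self {δ : ℂ} (hδ : -(1 / 2 : ℝ) < δ.re) (n : ℕ) :
    ∫ t in Set.Ioc (-π) π, (weight δ (circPt t) : ℂ) * angKernel δ n t t = n := by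
  have e : ∀ t, (weight δ (circPt t) : ℂ) * angKernel δ n t t =
      ∑ l ∈ Finset.range n, (hNorm δ l : ℂ)⁻¹ * ((weight δ (circPt t) : ℂ) *
          (conj ((fPoly δ l).eval (circPt t)) * (fPoly δ l).eval (circPt t))) := by
    intro t
    rw [angKernel, cdKernel, Finset.mul_sum]
    exact Finset.sum_congr rfl fun l _ => by ring
  rw [integral_congr_ae (ae_of_all _ e), integral_finsetSum _ fun l _ =>
    (integrableOn_weight_mul hδ (continuous_conj_mul_fPoly δ l l)).const_mul _]
  simp only [integral_const_mul, setIntegral_fPoly hδ, if_true]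
  rw [Finset.sum_congr rfl fun l _ => inv_mul_cancel₀
    (show (hNorm δ l : ℂ) ≠ 0 by exact_mod_cast (hNorm_pos hδ l).ne')]
  simp

/-- The product `∏ ‖f_l‖ ^ 2 / |lead f_l| ^ 2` of the squared norms of the monic polynomials. -/
def gramConst (δ : ℂ) (n : ℕ) : ℝ := ∏ l : Fin n, (hNorm δ l / ‖fLead δ l‖ ^ 2)

lemma gramConst_pos {δ : ℂ} (hδ : -(1 / 2 : ℝ) < δ.re) (n : ℕ) : 0 < gramConst δ n :=
  Finset.prod_pos fun l _ => div_pos (hNorm_pos hδ l)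
    (pow_pos (norm_pos_iff.2 (fLead_ne_zero hδ l)) 2)

/-- The joint density as a determinant. -/
theorem jointWeight_eq {δ : ℂ} (hδ : -(1 / 2 : ℝ) < δ.re) {n : ℕ} (θ : Fin n → ℝ) :
    (jointWeight (weight δ) θ : ℂ) = gramConst δ n *
      (((∏ i, weight δ (circPt (θ i)) : ℝ) : ℂ) * kdet (angKernel δ n) θ) := by
  set V := Matrix.vandermonde fun i => circPt (θ i) with hV
  -- Replacing monomials by monic polynomials of the same degrees is a unitriangular column
  -- operation.
  have h1 : V.det = (Matrix.of fun i (j : Fin n) =>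
      (C (fLead δ j)⁻¹ * fPoly δ j).eval (circPt (θ i))).det := by
    refine Matrix.det_eval_matrixOfPolynomials_eq_det_vandermonde _
      (fun j : Fin n => C (fLead δ j)⁻¹ * fPoly δ j) (fun j => ?_) fun j => ?_
    · rw [natDegree_C_mul (inv_ne_zero (fLead_ne_zero hδ j)), natDegree_fPoly hδ]
    · rw [Monic, leadingCoeff, natDegree_C_mul (inv_ne_zero (fLead_ne_zero hδ j)), coeff_C_mul,
        natDegree_fPoly hδ, coeff_fPoly_self hδ, inv_mul_cancel₀ (fLead_ne_zero hδ j)]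
  set P := Matrix.of fun i (j : Fin n) =>
      (C (fLead δ j)⁻¹ * fPoly δ j).eval (circPt (θ i)) with hP
  -- The kernel matrix factors as `conj P · diag · Pᵀ`, so its determinant is `|det V|²` divided by
  -- the product of the monic norms.
  have h2 : (Matrix.of fun i j => angKernel δ n (θ i) (θ j)) =
      (P.map conj * Matrix.diagonal fun l : Fin n => ((‖fLead δ l‖ ^ 2 / hNorm δ l : ℝ) : ℂ)) *
        P.transpose := by
    ext i j
    rw [Matrix.mul_apply]
    simp only [Matrix.of_apply, Matrix.mul_diagonal, Matrix.map_apply, Matrix.transpose_apply, hP,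
      eval_mul, eval_C, map_mul, map_inv₀]
    rw [angKernel, cdKernel, ← Fin.sum_univ_eq_sum_range (fun l =>
      conj ((fPoly δ l).eval (circPt (θ i))) * (fPoly δ l).eval (circPt (θ j)) / (hNorm δ l : ℂ))]
    refine Finset.sum_congr rfl fun l _ => ?_
    have hf := fLead_ne_zero hδ l
    have hf' : conj (fLead δ l) ≠ 0 := by simpa using hf
    have hh : (hNorm δ l : ℂ) ≠ 0 := by exact_mod_cast (hNorm_pos hδ l).ne'
    push_cast
    rw [← Complex.conj_mul']
    field_simp
  have h3 : kdet (angKernel δ n) θ = (gramConst δ n : ℂ)⁻¹ * (‖V.det‖ ^ 2 : ℝ) := by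
    have hconj : (P.map conj).det = conj P.det := (RingHom.map_det (starRingEnd ℂ) P).symm
    rw [kdet, h2, Matrix.det_mul, Matrix.det_mul, Matrix.det_transpose, Matrix.det_diagonal, hconj,
      ← h1, Complex.ofReal_pow, ← Complex.conj_mul', gramConst, Complex.ofReal_prod,
      ← Finset.prod_inv_distrib]
    simp only [← Complex.ofReal_inv, inv_div]
    ring
  have h4 : ‖V.det‖ ^ 2 = ∏ j, ∏ k ∈ Finset.Ioi j, ‖circPt (θ k) - circPt (θ j)‖ ^ 2 := by
    rw [hV, Matrix.det_vandermonde]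
    simp only [norm_prod, Finset.prod_pow]
  have hg : (gramConst δ n : ℂ) ≠ 0 := by exact_mod_cast (gramConst_pos hδ n).ne'
  rw [h3, jointWeight, ← h4]
  push_cast
  field_simp

lemma integral_wkdet_append {δ : ℂ} (hδ : -(1 / 2 : ℝ) < δ.re) {m k n : ℕ} (hk : m + k ≤ n)
    (x : Fin m → ℝ) :
    ∫ y in angleBox k, ((∏ i, weight δ (circPt (y i)) : ℝ) : ℂ) *
      kdet (angKernel δ n) (Fin.append x y) =
      ((n - m).descFactorial k : ℂ) * kdet (angKernel δ n) x := by
  have hK := continuous_angKernel δ n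
  refine integral_kdet_append (W := fun t => weight δ (circPt t)) hK (integrableOn_weight hδ)
    (fun x y => integrableOn_weight_mul hδ ?_) (integrableOn_weight_mul hδ ?_)
    (integral_angKernel_mul hδ n) (integral_angKernel_self hδ n) x k hk
  · exact (Continuous.comp (g := fun p : ℝ × ℝ => angKernel δ n p.1 p.2) hK
      (f := fun t => (x, t)) (by fun_prop)).mul
      (Continuous.comp (g := fun p : ℝ × ℝ => angKernel δ n p.1 p.2) hK
        (f := fun t => (t, y)) (by fun_prop))
  · exact Continuous.comp (g := fun p : ℝ × ℝ => angKernel δ n p.1 p.2) hK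
      (f := fun t => (t, t)) (by fun_prop)

lemma integral_jointWeight_append {δ : ℂ} (hδ : -(1 / 2 : ℝ) < δ.re) {m k : ℕ} (x : Fin m → ℝ) :
    ((∫ y in angleBox k, jointWeight (weight δ) (Fin.append x y) : ℝ) : ℂ) =
      gramConst δ (m + k) * (k ! : ℂ) * (((∏ i, weight δ (circPt (x i)) : ℝ) : ℂ) *
        kdet (angKernel δ (m + k)) x) := by
  refine (integral_ofReal (𝕜 := ℂ)).symm.trans ?_
  have e : ∀ y : Fin k → ℝ, (jointWeight (weight δ) (Fin.append x y) : ℂ) =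
      (gramConst δ (m + k) * ((∏ i, weight δ (circPt (x i)) : ℝ) : ℂ)) *
        (((∏ i, weight δ (circPt (y i)) : ℝ) : ℂ) *
          kdet (angKernel δ (m + k)) (Fin.append x y)) := by
    intro y
    rw [jointWeight_eq hδ, Fin.prod_univ_add]
    simp only [Fin.append_left, Fin.append_right]
    push_cast
    ring
  refine (integral_congr_ae (ae_of_all _ e)).trans ?_
  rw [integral_const_mul, integral_wkdet_append hδ le_rfl,
    Nat.add_sub_cancel_left, Nat.descFactorial_self]
  ring

lemma jointWeight_cast (w : ℂ → ℝ) {n m : ℕ} (h : n = m) (y : Fin m → ℝ) :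
    jointWeight w (y ∘ Fin.cast h) = jointWeight w y := by
  subst h; rfl

/-- All variables integrated out: the case `m = 0`, where the determinant is empty and equals `1`.
-/
lemma partitionFn_eq {δ : ℂ} (hδ : -(1 / 2 : ℝ) < δ.re) (n : ℕ) :
    partitionFn (weight δ) n = gramConst δ n * n ! := by
  have h := integral_jointWeight_append hδ (m := 0) (k := n) (fun i => i.elim0)
  have e : ∀ y : Fin n → ℝ, jointWeight (weight δ) (Fin.append (fun i : Fin 0 => i.elim0) y) =
      jointWeight (weight δ) y := fun y => by
    have : (Fin.append (fun i : Fin 0 => i.elim0) y : Fin (0 + n) → ℝ) =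
        y ∘ Fin.cast (Nat.zero_add n) := Fin.elim0_append y
    rw [this, jointWeight_cast]
  simp only [e] at h
  apply Complex.ofReal_injective
  rw [partitionFn, h]
  simp [kdet]

lemma partitionFn_pos {δ : ℂ} (hδ : -(1 / 2 : ℝ) < δ.re) (n : ℕ) :
    0 < partitionFn (weight δ) n := by
  rw [partitionFn_eq hδ]
  have := gramConst_pos hδ n
  positivity

lemma corr_add (w : ℂ → ℝ) (m k : ℕ) (x : Fin m → ℝ) :
    corr w (m + k) m x = ((m + k).descFactorial m : ℝ) *
      ((∫ y in angleBox k, jointWeight w (Fin.append x y)) / partitionFn w (m + k)) := by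
  have : ∀ k', k' = k → ∫ y in angleBox k', jointWeight w (Fin.append x y) =
      ∫ y in angleBox k, jointWeight w (Fin.append x y) := by
    rintro _ rfl; rfl
  rw [corr, this (m + k - m) (by omega)]

/-- The correlation functions are determinants of the reproducing kernel. -/
theorem corr_eq {δ : ℂ} (hδ : -(1 / 2 : ℝ) < δ.re) {n m : ℕ} (hm : m ≤ n) (x : Fin m → ℝ) :
    (corr (weight δ) n m x : ℂ) =
      ((∏ i, weight δ (circPt (x i)) : ℝ) : ℂ) * kdet (angKernel δ n) x := by
  obtain ⟨k, rfl⟩ := Nat.exists_eq_add_of_le hm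
  have hg : (gramConst δ (m + k) : ℂ) ≠ 0 := by exact_mod_cast (gramConst_pos hδ _).ne'
  have hf : ((m + k)! : ℂ) ≠ 0 := by exact_mod_cast (m + k).factorial_ne_zero
  have hd : ((k ! : ℕ) : ℂ) * ((m + k).descFactorial m : ℂ) = ((m + k)! : ℂ) := by
    have := Nat.factorial_mul_descFactorial (Nat.le_add_right m k)
    rw [Nat.add_sub_cancel_left] at this
    exact_mod_cast this
  rw [corr_add, Complex.ofReal_mul, Complex.ofReal_div, integral_jointWeight_append hδ,
    partitionFn_eq hδ]
  push_cast
  have hk : (k ! : ℂ) ≠ 0 := by exact_mod_cast k.factorial_ne_zero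
  rw [← hd] at hf ⊢
  field_simp

lemma integrableOn_corr {δ : ℂ} (hδ : -(1 / 2 : ℝ) < δ.re) {n m : ℕ} (hm : m ≤ n) :
    IntegrableOn (corr (weight δ) n m) (angleBox m) := by
  have h := (integrableOn_prod_mul (integrableOn_weight hδ)
    (continuous_kdet (continuous_angKernel δ n) m)).re
  refine h.congr (ae_of_all _ fun x => ?_)
  simp only
  rw [← corr_eq hδ hm]
  rfl

/-- The scaling limit of the correlation functions. -/
theorem tendsto_corr {δ : ℂ} (hδ : -(1 / 2 : ℝ) < δ.re) {m : ℕ} {θ : Fin m → ℝ}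
    (hθ : ∀ i, Admissible δ (θ i)) :
    Tendsto (fun n : ℕ => (((n : ℝ)⁻¹ ^ m * corr (weight δ) n m (fun i => θ i / n) : ℝ) : ℂ))
      atTop (𝓝 (Matrix.det (Matrix.of fun i j => limKernel δ (θ i) (θ j)))) := by
  -- The phase `e^{-i(θ_i - θ_j)/2}` is conjugation by a diagonal matrix, so the determinant ignores
  -- it.
  have hlim : Matrix.det (Matrix.of fun i j => limKernel δ (θ i) (θ j)) =
      Matrix.det (Matrix.of fun i j =>
        Complex.exp (-(Complex.I * ((θ i : ℂ) - θ j) / 2)) * limKernel δ (θ i) (θ j)) := by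
    have h1 : (Matrix.of fun i j =>
        Complex.exp (-(Complex.I * ((θ i : ℂ) - θ j) / 2)) * limKernel δ (θ i) (θ j)) =
        Matrix.of fun i j => Complex.exp (-(Complex.I * θ i / 2)) * (Matrix.of fun i j =>
          Complex.exp (Complex.I * θ j / 2) *
            (Matrix.of fun i j => limKernel δ (θ i) (θ j)) i j) i j := by
      ext i j
      simp only [Matrix.of_apply]
      rw [← mul_assoc, ← Complex.exp_add]
      congr 2; ring
    rw [h1, Matrix.det_mul_column, Matrix.det_mul_row, ← mul_assoc, ← Finset.prod_mul_distrib,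
      Finset.prod_eq_one fun i _ => by rw [← Complex.exp_add, neg_add_cancel, Complex.exp_zero],
      one_mul]
  rw [hlim]
  have ht : Tendsto (fun n : ℕ => Matrix.of fun i j => (n : ℂ)⁻¹ *
      kernel (nweight δ) n (circPt (θ i / n)) (circPt (θ j / n))) atTop
      (𝓝 (Matrix.of fun i j =>
        Complex.exp (-(Complex.I * ((θ i : ℂ) - θ j) / 2)) * limKernel δ (θ i) (θ j))) :=
    tendsto_pi_nhds.2 fun i => tendsto_pi_nhds.2 fun j => tendsto_kernel hδ (hθ i) (hθ j)
  have hdet := ((continuous_id (X := Matrix (Fin m) (Fin m) ℂ)).matrix_det.tendsto _).comp ht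
  refine hdet.congr' ?_
  filter_upwards [eventually_ge_atTop m] with n hn
  rw [Complex.ofReal_mul, corr_eq hδ hn, Function.comp_apply, id_eq]
  -- Since the weight is nonnegative, `√(w z * w ζ)` splits into a row factor and a column factor,
  -- which together restore `∏ w`.
  have h1 : (Matrix.of fun i j => (n : ℂ)⁻¹ *
      kernel (nweight δ) n (circPt (θ i / n)) (circPt (θ j / n))) =
      Matrix.of fun i j => ((n : ℂ)⁻¹ * (√(weight δ (circPt (θ i / n))) : ℂ)) *
        (Matrix.of fun i j => (√(weight δ (circPt (θ j / n))) : ℂ) *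
          (Matrix.of fun i j => angKernel δ n (θ i / n) (θ j / n)) i j) i j := by
    ext i j
    simp only [Matrix.of_apply]
    rw [kernel_nweight hδ, Real.sqrt_mul (weight_circPt_nonneg δ _), angKernel]
    push_cast
    ring
  rw [h1, Matrix.det_mul_column, Matrix.det_mul_row, kdet, Finset.prod_mul_distrib,
    Finset.prod_const, Finset.card_univ, Fintype.card_fin, mul_assoc, ← mul_assoc (∏ i, _),
    ← Finset.prod_mul_distrib]
  simp only [← Complex.ofReal_mul, Real.mul_self_sqrt (weight_circPt_nonneg δ _)]
  push_cast
  rfl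

/-! ### Joint intensities -/

lemma jointWeight_nonneg (δ : ℂ) {n : ℕ} (θ : Fin n → ℝ) : 0 ≤ jointWeight (weight δ) θ :=
  mul_nonneg (Finset.prod_nonneg fun _ _ => weight_circPt_nonneg δ _)
    (Finset.prod_nonneg fun _ _ => Finset.prod_nonneg fun _ _ => by positivity)

/-- The interaction is the squared modulus of a Vandermonde determinant, and permuting its rows
changes only the sign. -/
lemma jointWeight_comp_perm (w : ℂ → ℝ) {n : ℕ} (σ : Equiv.Perm (Fin n)) (θ : Fin n → ℝ) :
    jointWeight w (θ ∘ σ) = jointWeight w θ := by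
  have h : ∀ θ : Fin n → ℝ, ∏ j, ∏ k ∈ Finset.Ioi j, ‖circPt (θ k) - circPt (θ j)‖ ^ 2 =
      ‖(Matrix.vandermonde fun i => circPt (θ i)).det‖ ^ 2 := fun θ => by
    rw [Matrix.det_vandermonde]
    simp only [norm_prod, Finset.prod_pow]
  rw [jointWeight, jointWeight, h, h]
  congr 1
  · exact Equiv.prod_comp σ fun j => w (circPt (θ j))
  · have : (Matrix.vandermonde fun i => circPt ((θ ∘ σ) i)) =
        (Matrix.vandermonde fun i => circPt (θ i)).submatrix σ id := by
      ext i j; simp [Matrix.vandermonde_apply]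
    rw [this, Matrix.det_permute, norm_mul]
    rcases Int.units_eq_one_or (Equiv.Perm.sign σ) with h1 | h1 <;> simp [h1]

lemma integrableOn_jointWeight {δ : ℂ} (hδ : -(1 / 2 : ℝ) < δ.re) (n : ℕ) :
    IntegrableOn (fun θ : Fin n → ℝ => jointWeight (weight δ) θ) (angleBox n) := by
  have h := ((integrableOn_prod_mul (integrableOn_weight hδ)
    (continuous_kdet (continuous_angKernel δ n) n)).const_mul (gramConst δ n : ℂ)).re
  refine h.congr (ae_of_all _ fun x => ?_)
  simp only
  rw [← jointWeight_eq hδ]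
  rfl

lemma measurable_jointWeight (δ : ℂ) (n : ℕ) :
    Measurable fun θ : Fin n → ℝ => jointWeight (weight δ) θ := by
  unfold jointWeight
  have hc : Measurable circPt := continuous_circPt.measurable
  refine Measurable.mul ?_ ?_
  · exact Finset.measurable_prod _ fun i _ => (measurable_weight δ).comp (measurable_pi_apply i)
  · refine Finset.measurable_prod _ fun j _ => Finset.measurable_prod _ fun k _ => ?_
    exact (((hc.comp (measurable_pi_apply k)).sub (hc.comp (measurable_pi_apply j))).norm).pow_const 2

lemma integral_angleLaw {δ : ℂ} (hδ : -(1 / 2 : ℝ) < δ.re) (n : ℕ) (F : (Fin n → ℝ) → ℝ) :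
    ∫ θ, F θ ∂angleLaw (weight δ) n =
      ∫ θ in angleBox n, jointWeight (weight δ) θ / partitionFn (weight δ) n * F θ := by
  rw [angleLaw, integral_withDensity_eq_integral_toReal_smul
    ((measurable_jointWeight δ n).div_const _).ennreal_ofReal
    (ae_of_all _ fun _ => ENNReal.ofReal_lt_top)]
  congr 1
  ext θ
  rw [ENNReal.toReal_ofReal (div_nonneg (jointWeight_nonneg δ θ) (partitionFn_pos hδ n).le),
    smul_eq_mul]

/-- Expanding the product of sums gives all maps `Fin m → Fin n`; a non-injective map would place
one angle in two disjoint sets, so its term vanishes. -/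
lemma prod_counting_eq {n m : ℕ} {D : Fin m → Set ℝ} (hD : ∀ i, MeasurableSet (D i))
    (hdis : Pairwise fun i j => Disjoint (D i) (D j)) (θ : Fin n → ℝ) :
    ∏ i, (∑ j, Measure.dirac (θ j)).real (D i) =
      ∑ f : Fin m ↪ Fin n, ∏ i, (D i).indicator 1 (θ (f i)) := by
  have h1 : ∀ i, (∑ j, Measure.dirac (θ j)).real (D i) =
      ∑ j, (D i).indicator (1 : ℝ → ℝ) (θ j) := fun i => by
    rw [Measure.real, Measure.finsetSum_apply, ENNReal.toReal_sum fun j _ => measure_ne_top _ _]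
    refine Finset.sum_congr rfl fun j _ => ?_
    rw [Measure.dirac_apply' _ (hD i)]
    by_cases h : θ j ∈ D i <;> simp [h]
  simp only [h1]
  rw [Fintype.prod_sum]
  symm
  refine Finset.sum_of_injOn (fun f : Fin m ↪ Fin n => (f : Fin m → Fin n))
    (fun f _ g _ h => DFunLike.coe_injective h) (fun _ _ => by simp) (fun f _ hf => ?_)
    fun _ _ => rfl
  have hni : ¬ Function.Injective f := fun h => hf ⟨⟨f, h⟩, by simp, rfl⟩
  simp only [Function.Injective, not_forall] at hni
  obtain ⟨a, b, hab, hne⟩ := hni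
  by_cases ha : θ (f a) ∈ D a
  · refine Finset.prod_eq_zero (Finset.mem_univ b) ?_
    rw [Set.indicator_of_notMem]
    rw [← hab]
    exact Set.disjoint_left.1 (hdis hne) ha
  · exact Finset.prod_eq_zero (Finset.mem_univ a) (Set.indicator_of_notMem ha _)

/-- Lets the symmetry of the density reduce every choice of `m` angles to the first `m`. -/
lemma exists_perm_extending {m n : ℕ} (f g : Fin m ↪ Fin n) :
    ∃ σ : Equiv.Perm (Fin n), ∀ i, σ (f i) = g i := by
  classical
  refine ⟨((Equiv.ofInjective f f.injective).symm.trans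
    (Equiv.ofInjective g g.injective)).extendSubtype, fun i => ?_⟩
  rw [Equiv.extendSubtype_apply_of_mem _ _ (Set.mem_range_self i)]
  have : (⟨f i, Set.mem_range_self i⟩ : Set.range f) = Equiv.ofInjective f f.injective i := rfl
  rw [this]
  simp

lemma integrableOn_jointWeight_mul_indicator {δ : ℂ} (hδ : -(1 / 2 : ℝ) < δ.re) {n m : ℕ}
    {D : Fin m → Set ℝ} (hD : ∀ i, MeasurableSet (D i)) (f : Fin m → Fin n) :
    IntegrableOn (fun θ : Fin n → ℝ => jointWeight (weight δ) θ *
      ∏ i, (D i).indicator (1 : ℝ → ℝ) (θ (f i))) (angleBox n) := by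
  refine Integrable.mul_bdd (c := 1) (integrableOn_jointWeight hδ n) ?_ ?_
  · refine (Finset.measurable_prod _ fun i _ => ?_).aestronglyMeasurable
    exact (measurable_one.indicator (hD i)).comp (measurable_pi_apply (f i))
  · refine ae_of_all _ fun θ => ?_
    rw [norm_prod]
    refine Finset.prod_le_one (fun _ _ => norm_nonneg _) fun i _ => ?_
    by_cases h : θ (f i) ∈ D i <;> simp [h]

/-- The correlation functions are the joint intensities of the eigenvalue process. -/
theorem isJointIntensity_corr {δ : ℂ} (hδ : -(1 / 2 : ℝ) < δ.re) {n m : ℕ} (hm : m ≤ n) :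
    IsJointIntensity (angleLaw (weight δ) n) (corr (weight δ) n m) := by
  refine ⟨integrableOn_corr hδ hm, fun D hD hsub hdis => ?_⟩
  obtain ⟨k, rfl⟩ := Nat.exists_eq_add_of_le hm
  set Z := partitionFn (weight δ) (m + k) with hZ
  set g₀ : Fin m ↪ Fin (m + k) := Fin.castAddEmb k with hg₀
  have hperm : ∀ f : Fin m ↪ Fin (m + k),
      ∫ θ in angleBox (m + k), jointWeight (weight δ) θ *
        ∏ i, (D i).indicator (1 : ℝ → ℝ) (θ (f i)) =
      ∫ θ in angleBox (m + k), jointWeight (weight δ) θ *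
        ∏ i, (D i).indicator (1 : ℝ → ℝ) (θ (g₀ i)) := by
    intro f
    obtain ⟨σ, hσ⟩ := exists_perm_extending g₀ f
    rw [← integral_angleBox_perm σ fun θ => jointWeight (weight δ) θ *
        ∏ i, (D i).indicator (1 : ℝ → ℝ) (θ (g₀ i))]
    simp only [jointWeight_comp_perm, Function.comp_apply, hσ]
  -- Fubini over the first `m` and last `k` angles; the indicators cut `angleBox m` down to the
  -- product of the `D i`, which it contains by `hsub`.
  have hbase : ∫ θ in angleBox (m + k), jointWeight (weight δ) θ *
        ∏ i, (D i).indicator (1 : ℝ → ℝ) (θ (g₀ i)) =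
      ∫ x in Set.univ.pi D, ∫ y in angleBox k, jointWeight (weight δ) (Fin.append x y) := by
    have hDm : MeasurableSet (Set.univ.pi D) := MeasurableSet.univ_pi hD
    have hDsub : Set.univ.pi D ⊆ angleBox m := Set.pi_mono fun i _ => hsub i
    rw [integral_angleBox_append (integrableOn_jointWeight_mul_indicator hδ hD g₀),
      ← Set.inter_eq_self_of_subset_right hDsub, ← setIntegral_indicator hDm]
    congr 1
    ext x
    simp only [hg₀, Fin.castAddEmb_apply, Fin.append_left]
    rw [integral_mul_const]
    by_cases hx : x ∈ Set.univ.pi D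
    · rw [Set.indicator_of_mem hx, Finset.prod_eq_one fun i _ => by
        rw [Set.indicator_of_mem (hx i (Set.mem_univ i)), Pi.one_apply], mul_one]
    · rw [Set.indicator_of_notMem hx]
      simp only [Set.mem_univ_pi, not_forall] at hx
      obtain ⟨i, hi⟩ := hx
      rw [Finset.prod_eq_zero (Finset.mem_univ i) (Set.indicator_of_notMem hi _), mul_zero]
  rw [integral_angleLaw hδ]
  have e : ∀ θ : Fin (m + k) → ℝ, jointWeight (weight δ) θ / Z *
      ∏ i, (∑ j, Measure.dirac (θ j)).real (D i) =
      Z⁻¹ * ∑ f : Fin m ↪ Fin (m + k), jointWeight (weight δ) θ *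
        ∏ i, (D i).indicator (1 : ℝ → ℝ) (θ (f i)) := fun θ => by
    rw [prod_counting_eq hD hdis, ← Finset.mul_sum]
    ring
  -- All terms of the sum are equal, and the number of injections is the falling factorial in
  -- `corr`.
  rw [integral_congr_ae (ae_of_all _ e), integral_const_mul, integral_finsetSum _
    fun (f : Fin m ↪ Fin (m + k)) _ => integrableOn_jointWeight_mul_indicator hδ hD f, Finset.sum_congr rfl fun f _ => hperm f,
    Finset.sum_const, Finset.card_univ, Fintype.card_embedding_eq, Fintype.card_fin,
    Fintype.card_fin, hbase, nsmul_eq_mul]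
  simp only [corr_add]
  rw [integral_const_mul, integral_div]
  ring

end

end CircularJacobi

theorem mainTheorem7 (δ : ℂ) (hδ : -(1 / 2 : ℝ) < δ.re) :
    (∀ θ τ : ℝ, CircularJacobi.Admissible δ θ → CircularJacobi.Admissible δ τ →
      Tendsto
        (fun n : ℕ => (n : ℂ)⁻¹ *
          CircularJacobi.kernel (CircularJacobi.nweight δ) n
            (CircularJacobi.circPt (θ / n)) (CircularJacobi.circPt (τ / n)))
        atTop
        (𝓝 (Complex.exp (-(Complex.I * ((θ : ℂ) - τ) / 2)) * CircularJacobi.limKernel δ θ τ))) ∧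
    (∀ θ : ℝ, θ ≠ 0 → CircularJacobi.pCirc δ θ = CircularJacobi.pReal δ (-2 * θ⁻¹)) ∧
    (∀ n m : ℕ, m ≤ n →
      CircularJacobi.IsJointIntensity
        (CircularJacobi.angleLaw (CircularJacobi.weight δ) n)
        (CircularJacobi.corr (CircularJacobi.weight δ) n m)) ∧
    (∀ (m : ℕ) (θ : Fin m → ℝ), (∀ i, CircularJacobi.Admissible δ (θ i)) →
      Tendsto
        (fun n : ℕ => (((n : ℝ)⁻¹ ^ m *
          CircularJacobi.corr (CircularJacobi.weight δ) n m (fun i => θ i / n) : ℝ) : ℂ))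
        atTop
        (𝓝 (Matrix.det (Matrix.of fun i j => CircularJacobi.limKernel δ (θ i) (θ j))))) := by
  exact ⟨fun θ τ hθ hτ => CircularJacobi.tendsto_kernel hδ hθ hτ,
    fun θ hθ => CircularJacobi.pCirc_eq_pReal δ hθ,
    fun n m hm => CircularJacobi.isJointIntensity_corr hδ hm,
    fun m θ hθ => CircularJacobi.tendsto_corr hδ hθ⟩
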